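/- Let $k$ be an algebraically closed field of characteristic zero, $n$ a positive integer with $4\mid n$, $q\in k$ a primitive $n^2$-th root of unity, and $\mathfrak q=q^n$. Let $\mathbf{Q}$ be the associative unital $k$-algebra underlying the small quasi-quantum group $\mathbf{Qu}_q(\mathfrak{sl}_2)$, that is, the algebra generated by $\kappa,\hat\kappa,E,F$ with relations $$\kappa^n=1,\quad \hat\kappa^n=\kappa^{-2},\quad \kappa\hat\kappa=\hat\kappa\kappa,\quad \kappa E\kappa^{-1}=\mathfrak q E,\quad \kappa F\kappa^{-1}=\mathfrak q^{-1}F,$$ $$\hat\kappa E\hat\kappa^{-1}=\mathfrak q q^{-2}E,\quad \hat\kappa F\hat\kappa^{-1}=\mathfrak q^{-1}q^{2}F,\quad E^{n^2}=F^{n^2}=0,\quad FE-q^{-1}EF=1-\kappa^{-1}\hat\kappa .$$ A basic algebra of $\mathbf{Q}$ is a corner algebra $e\mathbf{Q}e$ (with unit $e$), where $e=f_1+\dots+f_r$ for pairwise orthogonal primitive idempotents $f_i\in\mathbf{Q}$ such that the left modules $\mathbf{Q}f_i$ are pairwise non-isomorphic and every $\mathbf{Q}p$, with $p$ a primitive idempotent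 of $\mathbf{Q}$, is isomorphic to some $\mathbf{Q}f_i$. Let $\mathbf h(-1,1)$ be the book algebra $k\langle y,x,g\rangle/(x^2,\,y^2,\,g^2-1,\,gx+xg,\,gy+yg,\,xy-yx)$, a Hopf algebra with $$\Delta(x)=x\otimes g+1\otimes x,\quad \Delta(y)=y\otimes 1+g\otimes y,\quad \Delta(g)=g\otimes g,$$ $$\varepsilon(x)=\varepsilon(y)=0,\quad \varepsilon(g)=1,\quad S(x)=-xg^{-1},\quad S(y)=-g^{-1}y,\quad S(g)=g^{-1}.$$ Then $\mathbf{Q}$ has a basic algebra, and on every basic algebra $B=e\mathbf{Q}e$ of $\mathbf{Q}$ there is a Hopf algebra structure, extending the given $k$-algebra structure of $B$, such that $$B\;\cong\;\mathbf h(-1,1)\otimes_k k\mathbb Z_{n^2/2}\qquad\text{as Hopf algebras,}$$ where $k\mathbb Z_{n^2/2}$ is the group algebra of the cyclic group of order $n^2/2$ and the tensor product has the usual tensor product Hopf algebra structure. -/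

import Mathlib

open scoped TensorProduct

noncomputable section

namespace QuasiFL

universe u

/-! ### The associative algebra underlying the small quasi-quantum group of `sl₂` -/

/-- The four generators `κ, κ̂, E, F`. -/
inductive QGen : Type
  | K | Khat | E | F

section Presentation

variable {k : Type u} [Field k]

open QGen FreeAlgebra

/-- The defining relations, with `𝔮 = q ^ n`.  For `n > 0` the relation `κ ^ n = 1` makes `κ`
invertible with inverse `κ ^ (n - 1)`, and `κ̂` is invertible because `κ̂ ^ n = κ ^ (-2)` is; so each
relation containing an inverse of `κ` or `κ̂` is written here without it, `κ ^ (-1)` being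
`κ ^ (n - 1)`. -/
inductive QRel (n : ℕ) (q : k) : FreeAlgebra k QGen → FreeAlgebra k QGen → Prop
  /-- `κ ^ n = 1` -/
  | K_pow : QRel n q (ι k K ^ n) 1
  /-- `κ̂ ^ n = κ ^ (-2)` -/
  | Khat_pow : QRel n q (ι k Khat ^ n * ι k K ^ 2) 1
  /-- `κ κ̂ = κ̂ κ` -/
  | K_Khat : QRel n q (ι k K * ι k Khat) (ι k Khat * ι k K)
  /-- `κ E κ⁻¹ = 𝔮 E` -/
  | K_E : QRel n q (ι k K * ι k E) (q ^ n • (ι k E * ι k K))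
  /-- `κ F κ⁻¹ = 𝔮⁻¹ F` -/
  | K_F : QRel n q (ι k K * ι k F) ((q ^ n)⁻¹ • (ι k F * ι k K))
  /-- `κ̂ E κ̂⁻¹ = 𝔮 q⁻² E` -/
  | Khat_E : QRel n q (ι k Khat * ι k E) ((q ^ n * (q ^ 2)⁻¹) • (ι k E * ι k Khat))
  /-- `κ̂ F κ̂⁻¹ = 𝔮⁻¹ q² F` -/
  | Khat_F : QRel n q (ι k Khat * ι k F) (((q ^ n)⁻¹ * q ^ 2) • (ι k F * ι k Khat))
  /-- `E ^ (n²) = 0` -/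
  | E_pow : QRel n q (ι k E ^ (n ^ 2)) 0
  /-- `F ^ (n²) = 0` -/
  | F_pow : QRel n q (ι k F ^ (n ^ 2)) 0
  /-- `F E - q⁻¹ E F = 1 - κ⁻¹ κ̂` -/
  | F_E : QRel n q (ι k F * ι k E - q⁻¹ • (ι k E * ι k F)) (1 - ι k K ^ (n - 1) * ι k Khat)

end Presentation

/-- The associative `k`-algebra generated by `κ, κ̂, E, F` subject to the relations `QRel`. -/
def Qusl2 (k : Type u) [Field k] (n : ℕ) (q : k) : Type u := RingQuot (QRel n q)

instance (k : Type u) [Field k] (n : ℕ) (q : k) : Ring (Qusl2 k n q) :=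
  inferInstanceAs (Ring (RingQuot (QRel n q)))

instance (k : Type u) [Field k] (n : ℕ) (q : k) : Algebra k (Qusl2 k n q) :=
  inferInstanceAs (Algebra k (RingQuot (QRel n q)))

/-! ### Basic algebras -/

section Basic

variable {R : Type u} [Ring R]

/-- A nonzero idempotent that is not a sum of two nonzero orthogonal idempotents. -/
structure IsPrimitiveIdempotent (e : R) : Prop where
  idem : IsIdempotentElem e
  ne_zero : e ≠ 0
  indecomposable : ∀ f g : R, IsIdempotentElem f → IsIdempotentElem g →
    f * g = 0 → g * f = 0 → f + g = e → f = 0 ∨ g = 0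

/-- `e = f₁ + ⋯ + fᵣ` where the `fᵢ` are pairwise orthogonal primitive idempotents, the left ideals
`R fᵢ` are pairwise non-isomorphic left `R`-modules, and for every primitive idempotent `p` of `R`
the left module `R p` is isomorphic to one of the `R fᵢ`.  The corner ring `e R e` is then the basic
algebra (basic subalgebra) of `R`.  Note that `Ideal.span {f}` is the left ideal `R f`. -/
def IsBasicIdempotent (e : R) : Prop :=
  ∃ (r : ℕ) (f : Fin r → R), OrthogonalIdempotents f ∧
    (∀ i, IsPrimitiveIdempotent (f i)) ∧
    (∀ i j, Nonempty (Ideal.span {f i} ≃ₗ[R] Ideal.span {f j}) → i = j) ∧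
    (∀ p : R, IsPrimitiveIdempotent p →
      ∃ i, Nonempty (Ideal.span {p} ≃ₗ[R] Ideal.span {f i})) ∧
    ∑ i, f i = e

theorem IsBasicIdempotent.idem {e : R} (he : IsBasicIdempotent e) : IsIdempotentElem e := by
  obtain ⟨r, f, hf, -, -, -, rfl⟩ := he
  exact hf.isIdempotentElem_sum

end Basic

section Corner

variable {k : Type u} [CommRing k] {R : Type u} [Ring R] [Algebra k R] {e : R}

instance cornerSMul (he : IsIdempotentElem e) : SMul k he.Corner where
  smul c a := ⟨c • a.1, by
    obtain ⟨r, hr⟩ := a.2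
    exact ⟨c • r, by simp [← hr]⟩⟩

theorem corner_smul_val (he : IsIdempotentElem e) (c : k) (a : he.Corner) :
    (c • a).1 = c • a.1 := rfl

instance cornerModule (he : IsIdempotentElem e) : Module k he.Corner where
  one_smul _ := Subtype.ext (one_smul k _)
  mul_smul _ _ _ := Subtype.ext (mul_smul _ _ _)
  smul_zero _ := Subtype.ext (smul_zero _)
  smul_add _ _ _ := Subtype.ext (smul_add _ _ _)
  add_smul _ _ _ := Subtype.ext (add_smul _ _ _)
  zero_smul _ := Subtype.ext (zero_smul k _)

/-- The corner `e R e` is a `k`-algebra, with unit `e` and the scalar action inherited from `R`. -/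
instance cornerAlgebra (he : IsIdempotentElem e) : Algebra k he.Corner :=
  Algebra.ofModule (fun _ _ _ => Subtype.ext (smul_mul_assoc _ _ _))
    (fun _ _ _ => Subtype.ext (mul_smul_comm _ _ _))

end Corner

/-! ### The book algebra `h(-1, 1)` -/

/-- The generators `x, y, g` of the book algebra. -/
inductive BGen : Type
  | x | y | g

section BookRel

variable (k : Type u) [Field k]

open BGen FreeAlgebra

/-- The relations `x ^ l, y ^ l, g ^ l - 1, g x - ζ x g, g y - ζ ^ m y g, x y - y x` for
`l = 2`, `ζ = -1`, `m = 1`. -/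
inductive BookRel : FreeAlgebra k BGen → FreeAlgebra k BGen → Prop
  | x_sq : BookRel (ι k x ^ 2) 0
  | y_sq : BookRel (ι k y ^ 2) 0
  | g_sq : BookRel (ι k g ^ 2) 1
  | g_x : BookRel (ι k g * ι k x) (-(ι k x * ι k g))
  | g_y : BookRel (ι k g * ι k y) (-(ι k y * ι k g))
  | x_y : BookRel (ι k x * ι k y) (ι k y * ι k x)

end BookRel

/-- The book algebra `h(-1, 1) = k⟨y, x, g⟩ / (x², y², g² - 1, gx + xg, gy + yg, xy - yx)`. -/
def Book (k : Type u) [Field k] : Type u := RingQuot (BookRel k)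

namespace Book

variable (k : Type u) [Field k]

instance : Ring (Book k) := inferInstanceAs (Ring (RingQuot (BookRel k)))

instance : Algebra k (Book k) := inferInstanceAs (Algebra k (RingQuot (BookRel k)))

/-- The quotient map from the free algebra. -/
def mk : FreeAlgebra k BGen →ₐ[k] Book k := RingQuot.mkAlgHom k (BookRel k)

theorem mk_surjective : Function.Surjective (mk k) := RingQuot.mkAlgHom_surjective k (BookRel k)

theorem mk_rel {a b : FreeAlgebra k BGen} (h : BookRel k a b) : mk k a = mk k b :=
  RingQuot.mkAlgHom_rel k h

/-- The class of a generator. -/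
def gen (i : BGen) : Book k := mk k (FreeAlgebra.ι k i)

/-- The generator `x`. -/
abbrev x : Book k := gen k .x
/-- The generator `y`. -/
abbrev y : Book k := gen k .y
/-- The generator `g`. -/
abbrev g : Book k := gen k .g

theorem xx : x k * x k = 0 := by simpa [gen, pow_two] using mk_rel k .x_sq
theorem yy : y k * y k = 0 := by simpa [gen, pow_two] using mk_rel k .y_sq
theorem gg : g k * g k = 1 := by simpa [gen, pow_two] using mk_rel k .g_sq
theorem gx : g k * x k = -(x k * g k) := by simpa [gen] using mk_rel k .g_x
theorem gy : g k * y k = -(y k * g k) := by simpa [gen] using mk_rel k .g_y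
theorem xy : x k * y k = y k * x k := by simpa [gen] using mk_rel k .x_y

variable {k}

/-- The algebra map out of the book algebra determined by images of the generators that satisfy the
relations. -/
def lift {B : Type*} [Ring B] [Algebra k B] (f : BGen → B)
    (hxx : f .x * f .x = 0) (hyy : f .y * f .y = 0) (hgg : f .g * f .g = 1)
    (hgx : f .g * f .x = -(f .x * f .g)) (hgy : f .g * f .y = -(f .y * f .g))
    (hxy : f .x * f .y = f .y * f .x) : Book k →ₐ[k] B :=
  RingQuot.liftAlgHom k ⟨FreeAlgebra.lift k f, by
    intro a b h
    cases h <;> simp [pow_two, *]⟩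

theorem lift_gen {B : Type*} [Ring B] [Algebra k B] (f : BGen → B)
    (hxx : f .x * f .x = 0) (hyy : f .y * f .y = 0) (hgg : f .g * f .g = 1)
    (hgx : f .g * f .x = -(f .x * f .g)) (hgy : f .g * f .y = -(f .y * f .g))
    (hxy : f .x * f .y = f .y * f .x) (i : BGen) :
    lift f hxx hyy hgg hgx hgy hxy (gen k i) = f i := by
  refine (RingQuot.liftAlgHom_mkAlgHom_apply k _ _ _).trans ?_
  exact FreeAlgebra.lift_ι_apply f i

theorem algHom_ext {B : Type*} [Ring B] [Algebra k B] {f f' : Book k →ₐ[k] B}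
    (h : ∀ i, f (gen k i) = f' (gen k i)) : f = f' := by
  have : f.comp (mk k) = f'.comp (mk k) := FreeAlgebra.hom_ext (funext h)
  ext a
  obtain ⟨a, rfl⟩ := mk_surjective k a
  exact DFunLike.congr_fun this a

theorem induction {P : Book k → Prop} (hc : ∀ c : k, P (algebraMap k _ c))
    (hg : ∀ i, P (gen k i)) (hm : ∀ a b, P a → P b → P (a * b))
    (ha : ∀ a b, P a → P b → P (a + b)) (a : Book k) : P a := by
  obtain ⟨a, rfl⟩ := mk_surjective k a
  induction a using FreeAlgebra.induction with
  | grade0 c => simpa using hc c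
  | grade1 i => exact hg i
  | mul a b h h' => simpa using hm _ _ h h'
  | add a b h h' => simpa using ha _ _ h h'

variable (k)

/-- `Δ(x) = x ⊗ g + 1 ⊗ x`, `Δ(y) = y ⊗ 1 + g ⊗ y`, `Δ(g) = g ⊗ g`. -/
def comulGen : BGen → Book k ⊗[k] Book k
  | .x => x k ⊗ₜ g k + 1 ⊗ₜ x k
  | .y => y k ⊗ₜ 1 + g k ⊗ₜ y k
  | .g => g k ⊗ₜ g k

/-- The comultiplication, as an algebra map. -/
def comulHom : Book k →ₐ[k] Book k ⊗[k] Book k :=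
  lift (comulGen k)
    (by simp [comulGen, mul_add, add_mul, xx, gx, TensorProduct.tmul_neg])
    (by simp [comulGen, mul_add, add_mul, yy, gy, TensorProduct.neg_tmul])
    (by simp [comulGen, gg, Algebra.TensorProduct.one_def])
    (by simp [comulGen, mul_add, add_mul, gx, TensorProduct.neg_tmul, TensorProduct.tmul_neg,
      add_comm])
    (by simp [comulGen, mul_add, add_mul, gy, TensorProduct.neg_tmul, TensorProduct.tmul_neg,
      add_comm])
    (by
      simp only [comulGen, mul_add, add_mul, Algebra.TensorProduct.tmul_mul_tmul, gx, gy, xy,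
        TensorProduct.neg_tmul, TensorProduct.tmul_neg, mul_one, one_mul]
      abel)

/-- `ε(x) = ε(y) = 0`, `ε(g) = 1`. -/
def counitGen : BGen → k
  | .x => 0
  | .y => 0
  | .g => 1

/-- The counit, as an algebra map. -/
def counitHom : Book k →ₐ[k] k :=
  lift (counitGen k) (by simp [counitGen]) (by simp [counitGen]) (by simp [counitGen])
    (by simp [counitGen]) (by simp [counitGen]) (by simp [counitGen])

/-- `S(x) = -x g⁻¹`, `S(y) = -g⁻¹ y`, `S(g) = g⁻¹`, where `g⁻¹ = g`. -/
def antipodeGen : BGen → Book k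
  | .x => -(x k * g k)
  | .y => -(g k * y k)
  | .g => g k

/-- The antipode, as an algebra map to the opposite algebra. -/
def antipodeHom : Book k →ₐ[k] (Book k)ᵐᵒᵖ :=
  lift (fun i => MulOpposite.op (antipodeGen k i))
    (by
      rw [← MulOpposite.op_mul, ← MulOpposite.op_zero, MulOpposite.op_inj]
      simp only [antipodeGen, neg_mul_neg]
      rw [mul_assoc, ← mul_assoc (g k), gx, neg_mul, mul_neg, mul_assoc (x k) (g k), gg, mul_one,
        xx, neg_zero])
    (by
      rw [← MulOpposite.op_mul, ← MulOpposite.op_zero, MulOpposite.op_inj]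
      simp only [antipodeGen, neg_mul_neg]
      rw [gy, neg_mul, mul_neg, mul_assoc, ← mul_assoc (g k) (y k), gy, neg_mul,
        mul_assoc (y k) (g k), gg, mul_one, mul_neg, yy, neg_zero, neg_zero, neg_zero])
    (by
      rw [← MulOpposite.op_mul, ← MulOpposite.op_one, MulOpposite.op_inj]
      simp only [antipodeGen, gg])
    (by
      rw [← MulOpposite.op_mul, ← MulOpposite.op_mul, ← MulOpposite.op_neg, MulOpposite.op_inj]
      simp only [antipodeGen, neg_mul, mul_neg, neg_neg]
      rw [← mul_assoc, gx, neg_mul])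
    (by
      rw [← MulOpposite.op_mul, ← MulOpposite.op_mul, ← MulOpposite.op_neg, MulOpposite.op_inj]
      simp only [antipodeGen, neg_mul, mul_neg, neg_neg]
      rw [mul_assoc, ← mul_neg, ← gy])
    (by
      rw [← MulOpposite.op_mul, ← MulOpposite.op_mul, MulOpposite.op_inj]
      simp only [antipodeGen, neg_mul_neg]
      rw [mul_assoc (g k), ← mul_assoc (y k), ← xy, mul_assoc (x k) (g k), ← mul_assoc (g k) (g k),
        gg, one_mul, ← mul_assoc, ← mul_assoc, gx, neg_mul, mul_assoc (x k), gy, mul_neg, neg_neg,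
        ← mul_assoc, mul_assoc _ (g k), gg, mul_one])

/-- The bialgebra structure of the book algebra. -/
instance instBialgebra : Bialgebra k (Book k) :=
  Bialgebra.ofAlgHom (comulHom k) (counitHom k)
    (algHom_ext fun i => by
      cases i <;> simp [comulHom, lift_gen, comulGen, TensorProduct.tmul_add,
        TensorProduct.add_tmul, Algebra.TensorProduct.one_def, add_assoc])
    (algHom_ext fun i => by
      cases i <;> simp [comulHom, counitHom, lift_gen, comulGen, counitGen])
    (algHom_ext fun i => by
      cases i <;> simp [comulHom, counitHom, lift_gen, comulGen, counitGen])

theorem comul_gen (i : BGen) : Coalgebra.comul (R := k) (gen k i) = comulGen k i :=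
  lift_gen _ _ _ _ _ _ _ i

theorem counit_gen (i : BGen) : Coalgebra.counit (R := k) (gen k i) = counitGen k i :=
  lift_gen _ _ _ _ _ _ _ i

/-- The antipode, as a linear map. -/
def antipodeLin : Book k →ₗ[k] Book k :=
  (MulOpposite.opLinearEquiv k).symm.toLinearMap ∘ₗ (antipodeHom k).toLinearMap

theorem antipodeLin_gen (i : BGen) : antipodeLin k (gen k i) = antipodeGen k i := by
  simp [antipodeLin, antipodeHom, lift_gen]

theorem antipodeLin_mul (a b : Book k) :
    antipodeLin k (a * b) = antipodeLin k b * antipodeLin k a := by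
  simp [antipodeLin]

theorem antipodeLin_algebraMap (c : k) :
    antipodeLin k (algebraMap k _ c) = algebraMap k _ c := by
  simp [antipodeLin]

open Coalgebra in
theorem antipode_left (a : Book k) :
    LinearMap.mul' k _ ((antipodeLin k).rTensor _ (comul (R := k) a)) =
      algebraMap k _ (counit (R := k) a) := by
  induction a using induction with
  | hc c =>
    simp [Bialgebra.comul_algebraMap, Algebra.TensorProduct.algebraMap_apply,
      antipodeLin_algebraMap]
  | hg i =>
    rw [comul_gen, counit_gen]
    have h1 : antipodeLin k 1 = 1 := by simpa using antipodeLin_algebraMap k 1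
    cases i <;> simp [comulGen, counitGen, antipodeLin_gen, antipodeGen, h1, gg, mul_assoc]
  | hm a b ha hb =>
    have key : ∀ s t : Book k ⊗[k] Book k,
        LinearMap.mul' k _ ((antipodeLin k).rTensor _ s) ∈ Set.range (algebraMap k (Book k)) →
        LinearMap.mul' k _ ((antipodeLin k).rTensor _ (s * t)) =
          LinearMap.mul' k _ ((antipodeLin k).rTensor _ s) *
            LinearMap.mul' k _ ((antipodeLin k).rTensor _ t) := by
      rintro s t ⟨c, hc⟩
      induction t using TensorProduct.induction_on with
      | zero => simp
      | add t t' h h' => simp only [mul_add, map_add, h, h']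
      | tmul u v =>
        have : ∀ s : Book k ⊗[k] Book k,
            LinearMap.mul' k _ ((antipodeLin k).rTensor _ (s * u ⊗ₜ v)) =
              antipodeLin k u * LinearMap.mul' k _ ((antipodeLin k).rTensor _ s) * v := by
          intro s
          induction s using TensorProduct.induction_on with
          | zero => simp
          | add s s' h h' => simp only [add_mul, mul_add, map_add, h, h']
          | tmul p r => simp [antipodeLin_mul, mul_assoc]
        rw [this, ← hc, ← Algebra.commutes c (antipodeLin k u)]
        simp [mul_assoc]
    rw [Bialgebra.comul_mul, key _ _ ⟨_, ha.symm⟩, ha, hb, Bialgebra.counit_mul, map_mul]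
  | ha a b ha hb => simp only [map_add, ha, hb]

open Coalgebra in
theorem antipode_right (a : Book k) :
    LinearMap.mul' k _ ((antipodeLin k).lTensor _ (comul (R := k) a)) =
      algebraMap k _ (counit (R := k) a) := by
  induction a using induction with
  | hc c =>
    have h1 : antipodeLin k 1 = 1 := by simpa using antipodeLin_algebraMap k 1
    simp [Bialgebra.comul_algebraMap, Algebra.TensorProduct.algebraMap_apply, h1]
  | hg i =>
    rw [comul_gen, counit_gen]
    have h1 : antipodeLin k 1 = 1 := by simpa using antipodeLin_algebraMap k 1
    cases i <;> simp [comulGen, counitGen, antipodeLin_gen, antipodeGen, h1, gg, ← mul_assoc]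
  | hm a b ha hb =>
    have key : ∀ s t : Book k ⊗[k] Book k,
        LinearMap.mul' k _ ((antipodeLin k).lTensor _ t) ∈ Set.range (algebraMap k (Book k)) →
        LinearMap.mul' k _ ((antipodeLin k).lTensor _ (s * t)) =
          LinearMap.mul' k _ ((antipodeLin k).lTensor _ s) *
            LinearMap.mul' k _ ((antipodeLin k).lTensor _ t) := by
      rintro s t ⟨c, hc⟩
      induction s using TensorProduct.induction_on with
      | zero => simp
      | add t t' h h' => simp only [add_mul, map_add, h, h']
      | tmul u v =>
        have : ∀ t : Book k ⊗[k] Book k,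
            LinearMap.mul' k _ ((antipodeLin k).lTensor _ (u ⊗ₜ v * t)) =
              u * LinearMap.mul' k _ ((antipodeLin k).lTensor _ t) * antipodeLin k v := by
          intro t
          induction t using TensorProduct.induction_on with
          | zero => simp
          | add s s' h h' => simp only [add_mul, mul_add, map_add, h, h']
          | tmul p r => simp [antipodeLin_mul, mul_assoc]
        rw [this, ← hc, mul_assoc, Algebra.commutes c (antipodeLin k v)]
        simp [mul_assoc]
    rw [Bialgebra.comul_mul, key _ _ ⟨_, hb.symm⟩, ha, hb, Bialgebra.counit_mul, map_mul]
  | ha a b ha hb => simp only [map_add, ha, hb]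

/-- The Hopf algebra structure of the book algebra `h(-1, 1)`. -/
instance instHopfAlgebra : HopfAlgebra k (Book k) where
  antipode := antipodeLin k
  mul_antipode_rTensor_comul := LinearMap.ext fun a => antipode_left k a
  mul_antipode_lTensor_comul := LinearMap.ext fun a => antipode_right k a

end Book

end QuasiFL

end

/-!
# The basic algebra of the small quasi-quantum group of `sl₂`

Put `N = n²` and `G = k[x, y] / (x², y²)`. The algebra `Q = Qusl2 k n q` is shown to be the
algebra of all matrices over `G` of a certain graded shape, from which its basic algebra can be
read off.

The representation (`Qusl2.rep`). For `0 ≤ c < N / 4` and a sign `ε`, let `v_b`, `b ∈ ZMod N`, be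
a cycle of weight vectors on which `κ` acts by `ε q ^ (n b)` and `κ̂` by `ε q ^ ((n - 2) b)`; `E`
raises and `F` lowers `b` by one. The relation between `E` and `F` says that the coefficients of
`F E` are `q ^ (-b) / (q - 1) * (s_b + const)` with `s_b = q ^ (b + 1) + q ^ (-b)`. Taking the
constant to be `-s_c + xy`, the constant term vanishes precisely at the two "crossings" `b = c`
and `b = -1 - c`. There `E` acts by `x` and `F` by a multiple of `y`, elsewhere `E` acts by `1`;
the nilpotency of `E` and `F` comes from `x² = y² = 0`, as each turn around the cycle meets both
crossings. Modulo `x` and `y`, the cycle falls apart into two simple modules, of dimensions `2c +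
1` and `N - 2c - 1`.

The image (`Qusl2.isArrowMatrixAlgebra_rep`). The eigenvalues of `κ`, `κ̂` and `F E` separate all
pairs of a block `(c, ε)` and a weight `b`, so the image contains the diagonal matrix units;
moving along the cycle with `E` and `F` gives all block diagonal matrices whose entries are even
(in `k1 + kxy`) between vectors of the same simple module and odd (in `kx + ky`) otherwise. These
form a space of dimension `N / 2 * N² * 2 = N³`. The `N³` ordered monomials span `Q`
(`Qusl2.finrank_le`), so the representation is faithful and its image is exactly this algebra.

Basic idempotents (`IsArrowMatrixAlgebra.isBasicIdempotent`). Diagonal matrix units are primitive,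
and two of them are equivalent if and only if they belong to the same simple module. Any primitive
idempotent has a diagonal entry with nonzero constant term, as its trace modulo the radical is a
rank, and therefore is equivalent to a diagonal matrix unit. Choosing one diagonal matrix unit for
each simple module gives a basic idempotent whose corner consists of families, indexed by the `N /
2` blocks, of `2 × 2` matrices over `G` with even diagonal and odd off-diagonal entries. This
matrix algebra is the book algebra (`mem_range_bookMatrix`). Any two basic idempotents are
equivalent, so every basic algebra is isomorphic to the product of `N / 2` copies of the book
algebra. As `q²` is a primitive `N / 2`-th root of unity, the discrete Fourier transform
identifies this product with the tensor product of the book algebra and the group algebra of the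
cyclic group of order `N / 2`, and the Hopf algebra structure is transported along this
isomorphism.
-/

open scoped TensorProduct

noncomputable section

namespace QuasiFL

set_option linter.unusedSectionVars false

universe u

/-! ### The graded coefficient ring `k[x, y] / (x², y²)` -/

section Coefficients

variable (k : Type u) [Field k]

/-- The commutative ring `k[x, y] / (x², y²)`, encoded as dual numbers over dual numbers; `x` is the
inner and `y` the outer infinitesimal. -/
def Coeff : Type u := DualNumber (DualNumber k)

namespace Coeff

instance : CommRing (Coeff k) := inferInstanceAs (CommRing (DualNumber (DualNumber k)))

instance : Algebra k (Coeff k) := inferInstanceAs (Algebra k (DualNumber (DualNumber k)))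

variable {k}

/-- The element with coordinates `a, b, c, d` in the basis `1, x, y, xy`. -/
def mk (a b c d : k) : Coeff k :=
  ((((a, b) : DualNumber k), ((c, d) : DualNumber k)) : DualNumber (DualNumber k))

/-- The coefficient of `1`. -/
def c1 (z : Coeff k) : k :=
  TrivSqZeroExt.fst (TrivSqZeroExt.fst (z : DualNumber (DualNumber k)))
/-- The coefficient of `x`. -/
def cx (z : Coeff k) : k :=
  TrivSqZeroExt.snd (TrivSqZeroExt.fst (z : DualNumber (DualNumber k)))
/-- The coefficient of `y`. -/
def cy (z : Coeff k) : k :=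
  TrivSqZeroExt.fst (TrivSqZeroExt.snd (z : DualNumber (DualNumber k)))
/-- The coefficient of `xy`. -/
def cw (z : Coeff k) : k :=
  TrivSqZeroExt.snd (TrivSqZeroExt.snd (z : DualNumber (DualNumber k)))

@[ext]
theorem ext {z w : Coeff k} (h1 : c1 z = c1 w) (hx : cx z = cx w) (hy : cy z = cy w)
    (hw : cw z = cw w) : z = w :=
  TrivSqZeroExt.ext (TrivSqZeroExt.ext h1 hx) (TrivSqZeroExt.ext hy hw)

section Coordinates

variable (z w : Coeff k) (r a b c d : k)

@[simp] theorem c1_mk : c1 (mk a b c d) = a := rfl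
@[simp] theorem cx_mk : cx (mk a b c d) = b := rfl
@[simp] theorem cy_mk : cy (mk a b c d) = c := rfl
@[simp] theorem cw_mk : cw (mk a b c d) = d := rfl
@[simp] theorem c1_zero : c1 (0 : Coeff k) = 0 := rfl
@[simp] theorem cx_zero : cx (0 : Coeff k) = 0 := rfl
@[simp] theorem cy_zero : cy (0 : Coeff k) = 0 := rfl
@[simp] theorem cw_zero : cw (0 : Coeff k) = 0 := rfl
@[simp] theorem c1_one : c1 (1 : Coeff k) = 1 := rfl
@[simp] theorem cx_one : cx (1 : Coeff k) = 0 := rfl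
@[simp] theorem cy_one : cy (1 : Coeff k) = 0 := rfl
@[simp] theorem cw_one : cw (1 : Coeff k) = 0 := rfl
@[simp] theorem c1_add : c1 (z + w) = c1 z + c1 w := rfl
@[simp] theorem cx_add : cx (z + w) = cx z + cx w := rfl
@[simp] theorem cy_add : cy (z + w) = cy z + cy w := rfl
@[simp] theorem cw_add : cw (z + w) = cw z + cw w := rfl
@[simp] theorem c1_neg : c1 (-z) = -c1 z := rfl
@[simp] theorem cx_neg : cx (-z) = -cx z := rfl
@[simp] theorem cy_neg : cy (-z) = -cy z := rfl
@[simp] theorem cw_neg : cw (-z) = -cw z := rfl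
@[simp] theorem c1_sub : c1 (z - w) = c1 z - c1 w := by simp [sub_eq_add_neg]
@[simp] theorem cx_sub : cx (z - w) = cx z - cx w := by simp [sub_eq_add_neg]
@[simp] theorem cy_sub : cy (z - w) = cy z - cy w := by simp [sub_eq_add_neg]
@[simp] theorem cw_sub : cw (z - w) = cw z - cw w := by simp [sub_eq_add_neg]
@[simp] theorem c1_smul : c1 (r • z) = r * c1 z := rfl
@[simp] theorem cx_smul : cx (r • z) = r * cx z := rfl
@[simp] theorem cy_smul : cy (r • z) = r * cy z := rfl
@[simp] theorem cw_smul : cw (r • z) = r * cw z := rfl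
@[simp] theorem c1_algebraMap : c1 (algebraMap k (Coeff k) r) = r := by
  simp [Algebra.algebraMap_eq_smul_one]
@[simp] theorem cx_algebraMap : cx (algebraMap k (Coeff k) r) = 0 := by
  simp [Algebra.algebraMap_eq_smul_one]
@[simp] theorem cy_algebraMap : cy (algebraMap k (Coeff k) r) = 0 := by
  simp [Algebra.algebraMap_eq_smul_one]
@[simp] theorem cw_algebraMap : cw (algebraMap k (Coeff k) r) = 0 := by
  simp [Algebra.algebraMap_eq_smul_one]
@[simp] theorem c1_mul : c1 (z * w) = c1 z * c1 w := rfl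
@[simp] theorem cx_mul : cx (z * w) = c1 z * cx w + cx z * c1 w := rfl
@[simp] theorem cy_mul : cy (z * w) = c1 z * cy w + cy z * c1 w := rfl
@[simp] theorem cw_mul :
    cw (z * w) = c1 z * cw w + cx z * cy w + cy z * cx w + cw z * c1 w := by
  change c1 z * cw w + cx z * cy w + (cy z * cx w + cw z * c1 w) = _
  ring

end Coordinates

instance : Nontrivial (Coeff k) :=
  ⟨1, 0, fun h => by simpa using congrArg c1 h⟩

/-- Taking constant coefficients, as an algebra map. -/
def c1Hom : Coeff k →ₐ[k] k where
  toFun := c1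
  map_one' := rfl
  map_mul' _ _ := rfl
  map_zero' := rfl
  map_add' _ _ := rfl
  commutes' := c1_algebraMap

@[simp] theorem c1Hom_apply (z : Coeff k) : c1Hom z = c1 z := rfl

/-- The element `x`. -/
def X : Coeff k := mk 0 1 0 0
/-- The element `y`. -/
def Y : Coeff k := mk 0 0 1 0
/-- The socle element `xy`. -/
def W : Coeff k := mk 0 0 0 1

theorem X_mul_X : (X : Coeff k) * X = 0 := by ext <;> simp [X]
theorem Y_mul_Y : (Y : Coeff k) * Y = 0 := by ext <;> simp [Y]
theorem X_mul_Y : (X : Coeff k) * Y = W := by ext <;> simp [X, Y, W]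
theorem Y_mul_X : (Y : Coeff k) * X = W := by ext <;> simp [X, Y, W]

end Coeff

open Coeff

/-- The morphisms between two vertices of the quiver with vertex set `T × Bool`: the vertices in
different components have no nonzero morphisms, and inside a component they are the even elements
`k1 + kxy` from a vertex to itself and the odd elements `kx + ky` between the two vertices. -/
def arrows {T : Type*} (v w : T × Bool) : Submodule k (Coeff k) where
  carrier := {z | (v.1 ≠ w.1 → z = 0) ∧ (v.2 = w.2 → cx z = 0 ∧ cy z = 0) ∧
    (v.2 ≠ w.2 → c1 z = 0 ∧ cw z = 0)}
  add_mem' := by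
    rintro a b ⟨h1, h2, h3⟩ ⟨h1', h2', h3'⟩
    refine ⟨fun h => by simp [h1 h, h1' h], fun h => ?_, fun h => ?_⟩
    · simp [h2 h, h2' h]
    · simp [h3 h, h3' h]
  zero_mem' := by simp
  smul_mem' := by
    rintro r a ⟨h1, h2, h3⟩
    refine ⟨fun h => by simp [h1 h], fun h => ?_, fun h => ?_⟩
    · simp [h2 h]
    · simp [h3 h]

variable {k}

theorem mem_arrows {T : Type*} {v w : T × Bool} {z : Coeff k} :
    z ∈ arrows k v w ↔ (v.1 ≠ w.1 → z = 0) ∧ (v.2 = w.2 → cx z = 0 ∧ cy z = 0) ∧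
      (v.2 ≠ w.2 → c1 z = 0 ∧ cw z = 0) := Iff.rfl

end Coefficients

/-! ### The book algebra as an algebra of graded `2 × 2` matrices -/

section BookMatrix

variable (k : Type u) [Field k]

open Coeff

/-- The images of the generators: `x` and `y` become odd multiples of the matrix exchanging the two
basis vectors, `g` becomes the parity. -/
def bookMatrixGen : BGen → Matrix Bool Bool (Coeff k)
  | .x => .of fun i j => if i = j then 0 else X
  | .y => .of fun i j => if i = j then 0 else Y
  | .g => .of fun i j => if i = j then (if i then 1 else -1) else 0

/-- The embedding of the book algebra into the `2 × 2` matrices over `k[x, y] / (x², y²)`. -/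
def bookMatrix : Book k →ₐ[k] Matrix Bool Bool (Coeff k) :=
  Book.lift (bookMatrixGen k)
    (by ext i j <;> cases i <;> cases j <;> simp [bookMatrixGen, Matrix.mul_apply, X_mul_X])
    (by ext i j <;> cases i <;> cases j <;> simp [bookMatrixGen, Matrix.mul_apply, Y_mul_Y])
    (by ext i j <;> cases i <;> cases j <;> simp [bookMatrixGen, Matrix.mul_apply])
    (by ext i j <;> cases i <;> cases j <;> simp [bookMatrixGen, Matrix.mul_apply])
    (by ext i j <;> cases i <;> cases j <;> simp [bookMatrixGen, Matrix.mul_apply])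
    (by ext i j <;> cases i <;> cases j <;> simp [bookMatrixGen, Matrix.mul_apply, X_mul_Y, Y_mul_X])

theorem bookMatrix_gen (i : BGen) : bookMatrix k (Book.gen k i) = bookMatrixGen k i :=
  Book.lift_gen _ _ _ _ _ _ _ i

/-- The monomials `1, x, y, xy, g, xg, yg, xyg`. -/
def bookMonomial : Fin 8 → Book k :=
  ![1, Book.x k, Book.y k, Book.x k * Book.y k, Book.g k, Book.x k * Book.g k,
    Book.y k * Book.g k, Book.x k * Book.y k * Book.g k]

theorem bookMonomial_span : Submodule.span k (Set.range (bookMonomial k)) = ⊤ := by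
  set V := Submodule.span k (Set.range (bookMonomial k)) with hV
  have hm (i : Fin 8) : bookMonomial k i ∈ V := Submodule.subset_span ⟨i, rfl⟩
  have h0 : (1 : Book k) ∈ V := hm 0
  have h1 : Book.x k ∈ V := hm 1
  have h2 : Book.y k ∈ V := hm 2
  have h3 : Book.x k * Book.y k ∈ V := hm 3
  have h4 : Book.g k ∈ V := hm 4
  have h5 : Book.x k * Book.g k ∈ V := hm 5
  have h6 : Book.y k * Book.g k ∈ V := hm 6
  have h7 : Book.x k * Book.y k * Book.g k ∈ V := hm 7
  have hxx (a : Book k) : Book.x k * (Book.x k * a) = 0 := by rw [← mul_assoc, Book.xx, zero_mul]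
  have hyy (a : Book k) : Book.y k * (Book.y k * a) = 0 := by rw [← mul_assoc, Book.yy, zero_mul]
  have hyx : Book.y k * Book.x k = Book.x k * Book.y k := (Book.xy k).symm
  have hyx' (a : Book k) : Book.y k * (Book.x k * a) = Book.x k * (Book.y k * a) := by
    rw [← mul_assoc, hyx, mul_assoc]
  have hgx' (a : Book k) : Book.g k * (Book.x k * a) = -(Book.x k * (Book.g k * a)) := by
    rw [← mul_assoc, Book.gx, neg_mul, mul_assoc]
  have hgy' (a : Book k) : Book.g k * (Book.y k * a) = -(Book.y k * (Book.g k * a)) := by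
    rw [← mul_assoc, Book.gy, neg_mul, mul_assoc]
  -- The span is stable under left multiplication by each generator.
  have hgen (i : BGen) (v : Book k) (hv : v ∈ V) : Book.gen k i * v ∈ V := by
    induction hv using Submodule.span_induction with
    | zero => simp
    | add a b _ _ ha hb => rw [mul_add]; exact V.add_mem ha hb
    | smul c a _ ha => rw [mul_smul_comm]; exact V.smul_mem c ha
    | mem v hv =>
      obtain ⟨j, rfl⟩ := hv
      have hj : bookMonomial k j = 1 ∨ bookMonomial k j = Book.x k ∨
          bookMonomial k j = Book.y k ∨ bookMonomial k j = Book.x k * Book.y k ∨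
          bookMonomial k j = Book.g k ∨ bookMonomial k j = Book.x k * Book.g k ∨
          bookMonomial k j = Book.y k * Book.g k ∨
          bookMonomial k j = Book.x k * Book.y k * Book.g k := by
        fin_cases j <;> simp [bookMonomial]
      rw [mul_assoc] at h7
      rcases hj with h | h | h | h | h | h | h | h <;> rw [h] <;> cases i <;>
        (try simp only [mul_assoc, mul_one, mul_zero, mul_neg, neg_neg, V.neg_mem_iff,
          V.zero_mem, Book.xx, Book.yy, Book.gg, Book.gx, Book.gy, hxx, hyy, hyx, hyx', hgx',
          hgy']) <;> assumption
  have hall (a : Book k) : ∀ v ∈ V, a * v ∈ V := by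
    induction a using Book.induction with
    | hc c => intro v hv; rw [← Algebra.smul_def]; exact V.smul_mem c hv
    | hg i => exact hgen i
    | hm a b ha hb => intro v hv; rw [mul_assoc]; exact ha _ (hb _ hv)
    | ha a b ha hb => intro v hv; rw [add_mul]; exact V.add_mem (ha _ hv) (hb _ hv)
  rw [eq_top_iff]
  intro a _
  simpa using hall a 1 h0

/-- The images of the monomials. -/
def bookMonomialMatrix : Fin 8 → Bool → Bool → Coeff k :=
  ![fun i j => if i = j then 1 else 0, fun i j => if i = j then 0 else X,
    fun i j => if i = j then 0 else Y, fun i j => if i = j then W else 0,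
    fun i j => if i = j then (if i then 1 else -1) else 0,
    fun i j => if i = j then 0 else (if i then -X else X),
    fun i j => if i = j then 0 else (if i then -Y else Y),
    fun i j => if i = j then (if i then W else -W) else 0]

theorem bookMatrix_monomial (l : Fin 8) (i j : Bool) :
    bookMatrix k (bookMonomial k l) i j = bookMonomialMatrix k l i j := by
  fin_cases l <;> cases i <;> cases j <;>
    simp [bookMonomial, bookMonomialMatrix, bookMatrix_gen, bookMatrixGen, Matrix.mul_apply,
      X_mul_Y]

/-- The eight monomials span the book algebra, and their images are linearly independent. -/
theorem bookMatrix_injective [NeZero (2 : k)] : Function.Injective (bookMatrix k) := by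
  rw [injective_iff_map_eq_zero]
  intro a ha
  have : a ∈ Submodule.span k (Set.range (bookMonomial k)) := by simp [bookMonomial_span]
  obtain ⟨c, rfl⟩ := (Submodule.mem_span_range_iff_exists_fun k).1 this
  have h2 : (2 : k) ≠ 0 := NeZero.ne _
  have key (r s : k) (h : r + s = 0) (h' : r + -s = 0) : r = 0 ∧ s = 0 := by
    have : (2 : k) * r = 0 := by linear_combination h + h'
    have hr : r = 0 := by simpa [h2] using this
    exact ⟨hr, by simpa [hr] using h⟩
  have e (i j : Bool) : (0 : Coeff k) =
      if i = j then mk (c 0 + (if j then c 4 else -c 4)) 0 0 (c 3 + if j then c 7 else -c 7)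
      else mk 0 (c 1 + if j then c 5 else -c 5) (c 2 + if j then c 6 else -c 6) 0 := by
    have := congrFun (congrFun ha i) j
    rw [map_sum] at this
    simp only [Fin.sum_univ_eight, map_smul, bookMatrix_monomial, Matrix.add_apply,
      Matrix.smul_apply] at this
    refine this.symm.trans ?_
    cases i <;> cases j <;> ext <;> simp [bookMonomialMatrix, X, Y, W]
  have e1 := e true true
  have e2 := e false false
  have e3 := e false true
  have e4 := e true false
  simp only [Coeff.ext_iff] at e1 e2 e3 e4
  simp at e1 e2 e3 e4
  have k1 := key _ _ e1.1.symm e2.1.symm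
  have k2 := key _ _ e1.2.symm e2.2.symm
  have k3 := key _ _ e3.1.symm e4.1.symm
  have k4 := key _ _ e3.2.symm e4.2.symm
  simp [Fin.sum_univ_eight, k1, k2, k3, k4]

/-- The image of the book algebra consists of all matrices with even diagonal entries and odd
off-diagonal entries. -/
theorem mem_range_bookMatrix [NeZero (2 : k)] (M : Matrix Bool Bool (Coeff k)) :
    M ∈ (bookMatrix k).range ↔ ∀ i j, M i j ∈ arrows k ((), i) ((), j) := by
  constructor
  · rintro ⟨a, rfl⟩
    change ∀ i j, bookMatrix k a i j ∈ _
    induction a using Book.induction with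
    | hc c =>
      intro i j
      rw [AlgHom.commutes]
      cases i <;> cases j <;> simp [mem_arrows, Matrix.algebraMap_matrix_apply]
    | hg l =>
      intro i j
      rw [bookMatrix_gen]
      cases l <;> cases i <;> cases j <;> simp [bookMatrixGen, mem_arrows, X, Y]
    | hm a b ha hb =>
      intro i j
      have ha' (i j) := mem_arrows.1 (ha i j)
      have hb' (i j) := mem_arrows.1 (hb i j)
      simp at ha' hb'
      rw [map_mul]
      cases i <;> cases j <;> simp [mem_arrows, Matrix.mul_apply, ha', hb']
    | ha a b ha hb =>
      intro i j
      rw [map_add]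
      exact Submodule.add_mem _ (ha i j) (hb i j)
  · intro h
    have hd (i j : Bool) := mem_arrows.1 (h i j)
    simp only [ne_eq, not_true_eq_false, false_imp_iff, true_and] at hd
    have h2 : (2 : k) ≠ 0 := NeZero.ne _
    let c : Fin 8 → k := ![(c1 (M true true) + c1 (M false false)) / 2,
      (cx (M false true) + cx (M true false)) / 2, (cy (M false true) + cy (M true false)) / 2,
      (cw (M true true) + cw (M false false)) / 2, (c1 (M true true) - c1 (M false false)) / 2,
      (cx (M false true) - cx (M true false)) / 2, (cy (M false true) - cy (M true false)) / 2,
      (cw (M true true) - cw (M false false)) / 2]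
    refine ⟨∑ l, c l • bookMonomial k l, ?_⟩
    have key (r s : k) : (r + s) / 2 + (r - s) / 2 = r := by field_simp; ring
    have key' (r s : k) : (r + s) / 2 + -((r - s) / 2) = s := by field_simp; ring
    ext1 i j
    change bookMatrix k (∑ l, c l • bookMonomial k l) i j = _
    rw [map_sum]
    simp only [Fin.sum_univ_eight, map_smul, Matrix.add_apply, Matrix.smul_apply,
      bookMatrix_monomial]
    have hd' := hd i j
    cases i <;> cases j <;> simp at hd' <;> ext <;>
      simp [bookMonomialMatrix, X, Y, W, hd', c, key, key']

end BookMatrix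

/-! ### Equivalence of idempotents -/

section IdempotentEquiv

variable {R : Type u} [Ring R]

/-- The equivalence of idempotents (Murray–von Neumann equivalence): `e = ab` and `f = ba` with
`a ∈ eRf` and `b ∈ fRe`. -/
def IdemEquiv (e f : R) : Prop :=
  ∃ a b, a * b = e ∧ b * a = f ∧ e * a = a ∧ a * f = a ∧ f * b = b ∧ b * e = b

theorem IdemEquiv.symm {e f : R} (h : IdemEquiv e f) : IdemEquiv f e := by
  obtain ⟨a, b, h1, h2, h3, h4, h5, h6⟩ := h
  exact ⟨b, a, h2, h1, h5, h6, h3, h4⟩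

theorem IdemEquiv.trans {e f g : R} (h : IdemEquiv e f) (h' : IdemEquiv f g) : IdemEquiv e g := by
  obtain ⟨a, b, h1, h2, h3, h4, h5, h6⟩ := h
  obtain ⟨a', b', h1', h2', h3', h4', h5', h6'⟩ := h'
  refine ⟨a * a', b' * b, ?_, ?_, ?_, ?_, ?_, ?_⟩
  · rw [mul_assoc, ← mul_assoc a', h1', h5, h1]
  · rw [mul_assoc, ← mul_assoc b, h2, h3', h2']
  · rw [← mul_assoc, h3]
  · rw [mul_assoc, h4']
  · rw [← mul_assoc, h5']
  · rw [mul_assoc, h6]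

theorem mem_span_singleton_idempotent {e x : R} (he : IsIdempotentElem e) :
    x ∈ Ideal.span {e} ↔ x * e = x := by
  rw [Ideal.mem_span_singleton']
  constructor
  · rintro ⟨a, rfl⟩
    rw [mul_assoc, he]
  · exact fun h => ⟨x, h⟩

/-- For idempotents, isomorphism of the left ideals `Re` and `Rf` is equivalence of `e` and `f`. -/
theorem nonempty_linearEquiv_iff {e f : R} (he : IsIdempotentElem e) (hf : IsIdempotentElem f) :
    Nonempty (Ideal.span {e} ≃ₗ[R] Ideal.span {f}) ↔ IdemEquiv e f := by
  have me {x : R} := mem_span_singleton_idempotent (x := x) he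
  have mf {x : R} := mem_span_singleton_idempotent (x := x) hf
  constructor
  · rintro ⟨φ⟩
    let e' : Ideal.span {e} := ⟨e, me.2 he⟩
    let f' : Ideal.span {f} := ⟨f, mf.2 hf⟩
    have ha : (φ e' : R) * f = φ e' := mf.1 (φ e').2
    have hb : (φ.symm f' : R) * e = φ.symm f' := me.1 (φ.symm f').2
    have ha' : e * (φ e' : R) = φ e' := by
      have : e • e' = e' := Subtype.ext he
      conv_rhs => rw [← this, map_smul]
      rfl
    have hb' : f * (φ.symm f' : R) = φ.symm f' := by
      have : f • f' = f' := Subtype.ext hf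
      conv_rhs => rw [← this, map_smul]
      rfl
    refine ⟨φ e', φ.symm f', ?_, ?_, ha', ha, hb', hb⟩
    · have : (φ e' : R) • f' = φ e' := Subtype.ext ha
      have h2 := congrArg φ.symm this
      rw [map_smul, φ.symm_apply_apply] at h2
      exact congrArg Subtype.val h2
    · have : (φ.symm f' : R) • e' = φ.symm f' := Subtype.ext hb
      have h2 := congrArg φ this
      rw [map_smul, φ.apply_symm_apply] at h2
      exact congrArg Subtype.val h2
  · rintro ⟨a, b, h1, h2, h3, h4, h5, h6⟩
    refine ⟨LinearEquiv.ofLinearMap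
      (((LinearMap.toSpanSingleton R R a).comp (Ideal.span {e}).subtype).codRestrict
        (Ideal.span {f}) fun x => mf.2 ?_)
      (((LinearMap.toSpanSingleton R R b).comp (Ideal.span {f}).subtype).codRestrict
        (Ideal.span {e}) fun x => me.2 ?_) ?_ ?_⟩
    · simp [mul_assoc, h4]
    · simp [mul_assoc, h6]
    · ext x
      simp [mul_assoc, h2, mf.1 x.2]
    · ext x
      simp [mul_assoc, h1, me.1 x.2]

/-- Equivalences between the members of two orthogonal families add up. -/
theorem IdemEquiv.sum {ι κ : Type*} [Fintype ι] [Fintype κ] {f : ι → R} {g : κ → R}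
    (hf : OrthogonalIdempotents f) (hg : OrthogonalIdempotents g) (σ : ι ≃ κ)
    (h : ∀ i, IdemEquiv (f i) (g (σ i))) : IdemEquiv (∑ i, f i) (∑ j, g j) := by
  classical
  choose a b h1 h2 h3 h4 h5 h6 using h
  rw [← σ.sum_comp g]
  have hfo (i j : ι) (hij : i ≠ j) : f i * f j = 0 := hf.ortho hij
  have hgo (i j : ι) (hij : i ≠ j) : g (σ i) * g (σ j) = 0 :=
    hg.ortho (σ.injective.ne hij)
  have single (u v w : ι → R) (huv : ∀ i, u i * v i = w i)
      (ho : ∀ i j, i ≠ j → u i * v j = 0) : (∑ i, u i) * ∑ j, v j = ∑ i, w i := by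
    rw [Finset.sum_mul_sum]
    refine Finset.sum_congr rfl fun i _ => ?_
    rw [Finset.sum_eq_single i (fun j _ hj => ho i j hj.symm) (by simp), huv]
  refine ⟨∑ i, a i, ∑ i, b i, single _ _ _ h1 ?_, single _ _ _ h2 ?_, single _ _ _ h3 ?_,
    single _ _ _ h4 ?_, single _ _ _ h5 ?_, single _ _ _ h6 ?_⟩ <;> intro i j hij
  · rw [← h4, ← h5, mul_assoc, ← mul_assoc (g _), hgo i j hij, zero_mul, mul_zero]
  · rw [← h6, ← h3, mul_assoc, ← mul_assoc (f _), hfo i j hij, zero_mul, mul_zero]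
  · rw [← h3, ← mul_assoc, hfo i j hij, zero_mul]
  · rw [← h4, mul_assoc, hgo i j hij, mul_zero]
  · rw [← h5, ← mul_assoc, hgo i j hij, zero_mul]
  · rw [← h6, mul_assoc, hfo i j hij, mul_zero]

/-- Any two basic idempotents are equivalent: the primitive summands of both represent each
isomorphism class of indecomposable projectives exactly once. -/
theorem IsBasicIdempotent.idemEquiv {e e' : R} (he : IsBasicIdempotent e)
    (he' : IsBasicIdempotent e') : IdemEquiv e e' := by
  obtain ⟨r, f, hf, hfp, hfi, hfa, rfl⟩ := he
  obtain ⟨s, g, hg, hgp, hgi, hga, rfl⟩ := he'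
  choose σ hσ using fun i => hga _ (hfp i)
  choose τ hτ using fun j => hfa _ (hgp j)
  refine IdemEquiv.sum hf hg ⟨σ, τ, fun i => ?_, fun j => ?_⟩ fun i => ?_
  · exact (hfi _ _ ⟨(hσ i).some.trans (hτ _).some⟩).symm
  · exact (hgi _ _ ⟨(hτ j).some.trans (hσ _).some⟩).symm
  · exact (nonempty_linearEquiv_iff (hf.idem i) (hg.idem _)).1 (hσ i)

theorem corner_mul_left {e : R} (he : IsIdempotentElem e) (x : he.Corner) : e * x.1 = x.1 :=
  ((Subsemigroup.mem_corner_iff he).1 x.2).1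

theorem corner_mul_right {e : R} (he : IsIdempotentElem e) (x : he.Corner) : x.1 * e = x.1 :=
  ((Subsemigroup.mem_corner_iff he).1 x.2).2

/-- Equivalent idempotents have isomorphic corner algebras, via `x ↦ b x a`. -/
theorem IdemEquiv.nonempty_corner_algEquiv {k : Type u} [CommRing k] [Algebra k R] {e f : R}
    (he : IsIdempotentElem e) (hf : IsIdempotentElem f) (h : IdemEquiv e f) :
    Nonempty (he.Corner ≃ₐ[k] hf.Corner) := by
  obtain ⟨a, b, h1, h2, h3, h4, h5, h6⟩ := h
  let φ : he.Corner →ₗ[k] hf.Corner :=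
    { toFun := fun x => ⟨b * x.1 * a, (Subsemigroup.mem_corner_iff hf).2
        ⟨by rw [← mul_assoc, ← mul_assoc, h5], by rw [mul_assoc, h4]⟩⟩
      map_add' := fun x y => Subtype.ext (by
        change b * (x.1 + y.1) * a = b * x.1 * a + b * y.1 * a
        rw [mul_add, add_mul])
      map_smul' := fun c x => Subtype.ext (by
        change b * (c • x.1) * a = c • (b * x.1 * a)
        rw [mul_smul_comm, smul_mul_assoc]) }
  have hφ (x : he.Corner) : (φ x).1 = b * x.1 * a := rfl
  let ψ : hf.Corner → he.Corner := fun x => ⟨a * x.1 * b, (Subsemigroup.mem_corner_iff he).2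
        ⟨by rw [← mul_assoc, ← mul_assoc, h3], by rw [mul_assoc, h6]⟩⟩
  have hψ (x : hf.Corner) : (ψ x).1 = a * x.1 * b := rfl
  refine ⟨AlgEquiv.ofLinearEquiv ⟨φ, ψ, fun x => Subtype.ext ?_, fun x => Subtype.ext ?_⟩
    (Subtype.ext ?_) fun x y => Subtype.ext ?_⟩
  · change a * (b * x.1 * a) * b = x.1
    rw [← mul_assoc, ← mul_assoc, h1, mul_assoc, h1, corner_mul_left, corner_mul_right]
  · change b * (a * x.1 * b) * a = x.1
    rw [← mul_assoc, ← mul_assoc, h2, mul_assoc, h2, corner_mul_left, corner_mul_right]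
  · change b * e * a = f
    rw [h6, h2]
  · change b * (x.1 * y.1) * a = b * x.1 * a * (b * y.1 * a)
    rw [mul_assoc (b * x.1), ← mul_assoc a, ← mul_assoc a, h1, corner_mul_left]
    simp only [mul_assoc]

end IdempotentEquiv

/-! ### Algebras of arrow-valued matrices -/

section ArrowMatrix

open Coeff Matrix

variable {k : Type u} [Field k] {Q : Type u} [Ring Q] [Algebra k Q] {I T : Type*} [Fintype I]
  [DecidableEq I]

/-- The homomorphism `Φ` identifies `Q` with the algebra of all matrices whose entry at `(i, j)` is
a combination of arrows between the vertices `π i` and `π j`. -/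
structure IsArrowMatrixAlgebra (π : I → T × Bool) (Φ : Q →ₐ[k] Matrix I I (Coeff k)) : Prop where
  injective : Function.Injective Φ
  mem_range : ∀ M, M ∈ Φ.range ↔ ∀ i j, M i j ∈ arrows k (π i) (π j)

theorem one_mem_arrows {v w : T × Bool} (h : v = w) : (1 : Coeff k) ∈ arrows k v w := by
  subst h; simp [mem_arrows]

/-- An idempotent matrix over `k[x, y] / (x², y²)` whose diagonal has zero constant terms
vanishes. -/
theorem idempotent_matrix_eq_zero [CharZero k] {M : Matrix I I (Coeff k)} (hM : M * M = M)
    (h : ∀ i, c1 (M i i) = 0) : M = 0 := by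
  -- In characteristic zero the trace of an idempotent matrix over `k` is its rank.
  have h1 (i j : I) : c1 (M i j) = 0 := by
    let P : Matrix I I k := M.map c1Hom
    have hP : P * P = P := by
      rw [← Matrix.map_mul, hM]
    have hid : IsIdempotentElem (Matrix.toLin' P) := by
      rw [IsIdempotentElem, Module.End.mul_eq_comp, ← Matrix.toLin'_mul, hP]
    have : Matrix.toLin' P = 0 := by
      rw [← LinearMap.IsIdempotentElem.trace_eq_zero_iff hid, Matrix.trace_toLin'_eq]
      exact Finset.sum_eq_zero fun i _ => h i
    have : P = 0 := by simpa using this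
    exact congrFun (congrFun this i) j
  have hsum (i j : I) : M i j = ∑ l, M i l * M l j := by
    conv_lhs => rw [← hM, Matrix.mul_apply]
  -- The entries lie in the radical, whose square is spanned by `xy` and whose cube is zero.
  have h2 (i j : I) : cx (M i j) = 0 ∧ cy (M i j) = 0 := by
    rw [hsum]
    refine Finset.sum_induction _ (fun z => cx z = 0 ∧ cy z = 0) ?_ (by simp) ?_
    · rintro a b ⟨ha, ha'⟩ ⟨hb, hb'⟩; simp [*]
    · intro l _; simp [h1]
  have h3 (i j : I) : cw (M i j) = 0 := by
    rw [hsum]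
    refine Finset.sum_induction _ (fun z => cw z = 0) ?_ (by simp) ?_
    · rintro a b ha hb; simp [*]
    · intro l _; simp [h1, h2]
  ext i j <;> simp [h1, h2, h3]

namespace IsArrowMatrixAlgebra

variable {π : I → T × Bool} {Φ : Q →ₐ[k] Matrix I I (Coeff k)} (h : IsArrowMatrixAlgebra π Φ)

include h

theorem apply_mem (q : Q) (i j : I) : Φ q i j ∈ arrows k (π i) (π j) :=
  (h.mem_range _).1 ⟨q, rfl⟩ i j

theorem exists_single {i j : I} {z : Coeff k} (hz : z ∈ arrows k (π i) (π j)) :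
    ∃ q, Φ q = single i j z := by
  refine (h.mem_range _).2 fun i' j' => ?_
  rw [Matrix.single_apply]
  split_ifs with hij
  · obtain ⟨rfl, rfl⟩ := hij
    exact hz
  · exact Submodule.zero_mem _

/-- An element of the algebra whose image is the diagonal matrix unit at `i`. -/
def diag (i : I) : Q := (h.exists_single (one_mem_arrows (k := k) (rfl : π i = π i))).choose

theorem map_diag (i : I) : Φ (h.diag i) = single i i 1 :=
  (h.exists_single (one_mem_arrows (k := k) (rfl : π i = π i))).choose_spec

theorem orthogonalIdempotents_diag : OrthogonalIdempotents h.diag where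
  idem i := h.injective (by simp [map_diag])
  ortho i j hij := h.injective (by simp [map_diag, hij])

theorem map_eq_single {i j : I} {q : Q} (hi : h.diag i * q = q) (hj : q * h.diag j = q) :
    Φ q = single i j (Φ q i j) := by
  conv_lhs => rw [← hj, ← hi, map_mul, map_mul, map_diag, map_diag, single_mul_mul_single]
  simp

/-- The corner at a diagonal idempotent is the local ring `k1 + kxy`. -/
theorem isPrimitiveIdempotent_diag [CharZero k] (i : I) : IsPrimitiveIdempotent (h.diag i) := by
  refine ⟨h.orthogonalIdempotents_diag.idem i, fun h0 => ?_, fun f g hf hg hfg hgf hs => ?_⟩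
  · have := congrFun (congrFun (congrArg Φ h0) i) i
    simp [map_diag] at this
  · have hf1 : h.diag i * f = f := by rw [← hs, add_mul, hgf, add_zero, hf]
    have hf2 : f * h.diag i = f := by rw [← hs, mul_add, hfg, add_zero, hf]
    have hΦ := h.map_eq_single hf1 hf2
    have hm := (mem_arrows.1 (h.apply_mem f i i)).2.1 rfl
    set z := Φ f i i with hz
    have hzz : z * z = z := by
      have := congrFun (congrFun (congrArg Φ hf) i) i
      rw [map_mul, hΦ] at this
      simpa using this
    have e1 := congrArg c1 hzz
    have e2 := congrArg cw hzz
    simp only [c1_mul, cw_mul, hm.1, hm.2, zero_mul, add_zero] at e1 e2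
    rcases IsIdempotentElem.iff_eq_zero_or_one.1 e1 with h0 | h0
    · left
      refine h.injective ?_
      have : z = 0 := by
        ext
        · simpa using h0
        · simp [hm]
        · simp [hm]
        · rw [h0] at e2
          simpa using e2.symm
      rw [hΦ, this, map_zero, single_zero]
    · right
      have : z = 1 := by
        ext
        · simpa using h0
        · simp [hm]
        · simp [hm]
        · rw [h0] at e2
          simpa using e2
      have hfd : f = h.diag i := h.injective (by rw [hΦ, this, map_diag])
      rw [hfd] at hs
      simpa using hs

theorem idemEquiv_diag_iff {i j : I} : IdemEquiv (h.diag i) (h.diag j) ↔ π i = π j := by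
  constructor
  · rintro ⟨a, b, h1, -, h3, h4, h5, h6⟩
    by_contra hij
    have ha := h.map_eq_single h3 h4
    have hb := h.map_eq_single h5 h6
    have := congrFun (congrFun (congrArg Φ h1) i) i
    rw [map_mul, ha, hb, map_diag, single_mul_single_same, single_apply_same,
      single_apply_same] at this
    have e := congrArg c1 this
    obtain ⟨m1, -, m3⟩ := mem_arrows.1 (h.apply_mem a i j)
    have : c1 (Φ a i j) = 0 := by
      by_cases ht : (π i).1 = (π j).1
      · exact (m3 fun hs => hij (Prod.ext ht hs)).1
      · simp [m1 ht]
    simp [this] at e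
  · intro hij
    obtain ⟨a, ha⟩ := h.exists_single (one_mem_arrows (k := k) hij)
    obtain ⟨b, hb⟩ := h.exists_single (one_mem_arrows (k := k) hij.symm)
    refine ⟨a, b, ?_, ?_, ?_, ?_, ?_, ?_⟩ <;> refine h.injective ?_ <;>
      simp [ha, hb, map_diag]

/-- Every primitive idempotent is equivalent to a diagonal one: some diagonal entry of its image has
an invertible constant term, which makes the diagonal idempotent at this place equivalent to a
summand. -/
theorem exists_idemEquiv_diag [CharZero k] {p : Q} (hp : IsPrimitiveIdempotent p) :
    ∃ i, IdemEquiv p (h.diag i) := by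
  obtain ⟨i, hi⟩ : ∃ i, c1 (Φ p i i) ≠ 0 := by
    by_contra! hc
    refine hp.ne_zero (h.injective ?_)
    rw [map_zero]
    exact idempotent_matrix_eq_zero (by rw [← map_mul, hp.idem]) hc
  refine ⟨i, ?_⟩
  have hm := (mem_arrows.1 (h.apply_mem p i i)).2.1 rfl
  let z : Coeff k := Coeff.mk (c1 (Φ p i i))⁻¹ 0 0 (-(cw (Φ p i i) / c1 (Φ p i i) ^ 2))
  have hz : z * Φ p i i = 1 := by
    ext <;> simp [z, hi, hm]
    field_simp
    ring
  obtain ⟨u, hu⟩ := h.exists_single (i := i) (j := i) (z := z) (by simp [mem_arrows, z])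
  have hd := h.orthogonalIdempotents_diag.idem i
  have hdu : h.diag i * u = u := h.injective (by simp [hu, map_diag])
  have hud : u * h.diag i = u := h.injective (by simp [hu, map_diag])
  have hupd : u * p * h.diag i = h.diag i :=
    h.injective (by rw [map_mul, map_mul, hu, map_diag, single_mul_mul_single, hz, mul_one])
  have hpp : p * p = p := hp.idem
  have hβα : p * h.diag i * (u * p) = p * u * p := by
    rw [← mul_assoc, mul_assoc p, hdu]
  have hαβ : u * p * (p * h.diag i) = h.diag i := by
    rw [← mul_assoc, mul_assoc u, hpp, hupd]
  set c := p * u * p with hc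
  have hcc : c * c = c := by
    rw [← hβα, mul_assoc, ← mul_assoc (u * p), hαβ, ← mul_assoc (h.diag i), hdu]
  have hpc : p * c = c := by rw [hc, ← mul_assoc, ← mul_assoc, hpp]
  have hcp : c * p = c := by rw [hc, mul_assoc, hpp]
  have key := hp.indecomposable c (p - c) hcc
    (by simp [IsIdempotentElem, mul_sub, sub_mul, hpp, hcc, hpc, hcp])
    (by rw [mul_sub, hcp, hcc, sub_self]) (by rw [sub_mul, hpc, hcc, sub_self])
    (add_sub_cancel _ _)
  have hcp' : c = p := by
    rcases key with h0 | h0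
    · exfalso
      refine (h.isPrimitiveIdempotent_diag i).ne_zero ?_
      have : h.diag i = u * p * (p * h.diag i * (u * p)) * (p * h.diag i) := by
        rw [← mul_assoc (u * p), hαβ, mul_assoc, hαβ, hd]
      rw [this, hβα, h0, mul_zero, zero_mul]
    · exact (sub_eq_zero.1 h0).symm
  refine ⟨p * h.diag i, u * p, by rw [hβα, hcp'], hαβ, ?_, ?_, ?_, ?_⟩
  · rw [← mul_assoc, hpp]
  · rw [mul_assoc, hd]
  · rw [← mul_assoc, hdu]
  · rw [mul_assoc, hpp]

/-- One diagonal idempotent for each vertex. -/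
theorem isBasicIdempotent [CharZero k] [Fintype T] {o : T × Bool → I} (ho : ∀ v, π (o v) = v) :
    IsBasicIdempotent (∑ v, h.diag (o v)) := by
  have hinj : Function.Injective o := fun v w hvw => by rw [← ho v, hvw, ho]
  let ν := Fintype.equivFin (T × Bool)
  have hid := h.orthogonalIdempotents_diag.idem
  refine ⟨Fintype.card (T × Bool), fun i => h.diag (o (ν.symm i)), ?_, ?_, ?_, ?_, ?_⟩
  · exact ⟨fun i => hid _, fun i j hij =>
      h.orthogonalIdempotents_diag.ortho (hinj.ne (ν.symm.injective.ne hij))⟩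
  · exact fun i => h.isPrimitiveIdempotent_diag _
  · intro i j hij
    rw [nonempty_linearEquiv_iff (hid _) (hid _), h.idemEquiv_diag_iff, ho, ho] at hij
    exact ν.symm.injective hij
  · intro p hp
    obtain ⟨i, hi⟩ := h.exists_idemEquiv_diag hp
    refine ⟨ν (π i), (nonempty_linearEquiv_iff hp.idem (hid _)).2 (hi.trans ?_)⟩
    rw [h.idemEquiv_diag_iff, ν.symm_apply_apply, ho]
  · exact ν.symm.sum_comp fun v => h.diag (o v)

theorem map_sum_diag [Fintype T] [DecidableEq T] {o : T × Bool → I} (ho : ∀ v, π (o v) = v) :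
    Φ (∑ v, h.diag (o v)) = diagonal fun i => if o (π i) = i then 1 else 0 := by
  ext1 i j
  rw [map_sum, Matrix.sum_apply, diagonal_apply]
  simp only [map_diag, single_apply]
  split_ifs with hij hi
  · subst hij
    rw [Finset.sum_eq_single (π i)]
    · simp [hi]
    · rintro v - hv
      rw [if_neg]
      rintro ⟨rfl, -⟩
      exact hv (ho v).symm
    · simp
  · refine Finset.sum_eq_zero fun v _ => if_neg ?_
    rintro ⟨rfl, -⟩
    exact hi (by rw [ho])
  · refine Finset.sum_eq_zero fun v _ => if_neg ?_
    rintro ⟨rfl, h2⟩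
    exact hij h2

/-- The corner algebra of the sum of one diagonal idempotent for each vertex is the algebra of
families of graded `2 × 2` matrices, that is, a power of the book algebra. -/
theorem nonempty_corner_algEquiv [NeZero (2 : k)] [Fintype T] [DecidableEq T] {o : T × Bool → I}
    (ho : ∀ v, π (o v) = v) (he : IsIdempotentElem (∑ v, h.diag (o v))) :
    Nonempty (he.Corner ≃ₐ[k] (T → Book k)) := by
  have hinj : Function.Injective o := fun v w hvw => by rw [← ho v, hvw, ho]
  have hzero (x : he.Corner) (i j : I) (hij : ¬(o (π i) = i ∧ o (π j) = j)) : Φ x.1 i j = 0 := by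
    rw [← corner_mul_right he x, ← corner_mul_left he x, map_mul, map_mul, h.map_sum_diag ho,
      mul_diagonal, diagonal_mul]
    rcases not_and_or.1 hij with h0 | h0 <;> simp [h0]
  let θ : he.Corner →ₐ[k] (T → Matrix Bool Bool (Coeff k)) := AlgHom.ofLinearMap
    { toFun := fun x t => .of fun s s' => Φ x.1 (o (t, s)) (o (t, s'))
      map_add' := fun x y => by
        ext1 t; ext1 s s'
        exact congrFun (congrFun (map_add Φ x.1 y.1) _) _
      map_smul' := fun c x => by
        ext1 t; ext1 s s'
        exact congrFun (congrFun (map_smul Φ c x.1) _) _ }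
    (by
      ext1 t; ext1 s s'
      change Φ (∑ v, h.diag (o v)) (o (t, s)) (o (t, s')) = (1 : Matrix _ _ _) s s'
      rw [h.map_sum_diag ho, diagonal_apply, one_apply, ho]
      simp [hinj.eq_iff])
    (fun x y => by
      ext1 t; ext1 s s'
      change Φ (x.1 * y.1) (o (t, s)) (o (t, s')) = ∑ s'', Φ x.1 (o (t, s)) (o (t, s'')) *
        Φ y.1 (o (t, s'')) (o (t, s'))
      rw [map_mul, mul_apply, ← Finset.sum_subset (Finset.subset_univ (Finset.univ.image
        fun s => o (t, s))), Finset.sum_image]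
      · intro s₁ _ s₂ _ hs
        simpa using hinj hs
      · intro l _ hl
        by_cases hb : o (π l) = l
        · have : (π l).1 ≠ t := by
            rintro rfl
            exact hl (Finset.mem_image.2 ⟨(π l).2, Finset.mem_univ _, hb⟩)
          rw [(mem_arrows.1 (h.apply_mem x.1 (o (t, s)) l)).1 (by rw [ho]; exact this.symm),
            zero_mul]
        · rw [hzero x _ _ (fun hc => hb hc.2), zero_mul])
  have hθ (x : he.Corner) (t : T) (s s' : Bool) : θ x t s s' = Φ x.1 (o (t, s)) (o (t, s')) := rfl
  let ξ : (T → Book k) →ₐ[k] (T → Matrix Bool Bool (Coeff k)) :=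
    AlgHom.pi fun t => (bookMatrix k).comp (Pi.evalAlgHom k _ t)
  have hξ : Function.Injective ξ := fun a b hab =>
    funext fun t => bookMatrix_injective k (congrFun hab t)
  have hθi : Function.Injective θ := by
    intro x y hxy
    refine Subtype.ext (h.injective ?_)
    ext1 i j
    by_cases hij : o (π i) = i ∧ o (π j) = j
    · by_cases ht : (π i).1 = (π j).1
      · have := congrFun (congrFun (congrFun hxy (π i).1) (π i).2) (π j).2
        rw [hθ, hθ] at this
        have hj : ((π i).1, (π j).2) = π j := Prod.ext ht rfl
        rwa [hj, hij.2, Prod.mk.eta, hij.1] at this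
      · rw [(mem_arrows.1 (h.apply_mem x.1 i j)).1 ht, (mem_arrows.1 (h.apply_mem y.1 i j)).1 ht]
    · rw [hzero x i j hij, hzero y i j hij]
  have hrange : θ.range = ξ.range := by
    ext N
    constructor
    · rintro ⟨x, rfl⟩
      have (t : T) : θ x t ∈ (bookMatrix k).range := by
        rw [mem_range_bookMatrix]
        intro s s'
        have := mem_arrows.1 (h.apply_mem x.1 (o (t, s)) (o (t, s')))
        rw [ho, ho] at this
        exact mem_arrows.2 ⟨fun h => absurd rfl h, this.2⟩
      choose a ha using this
      exact ⟨a, funext ha⟩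
    · rintro ⟨a, rfl⟩
      have hN (t : T) := (mem_range_bookMatrix k _).1 ⟨a t, rfl⟩
      set N := ξ a with hNdef
      change ∀ t i j, N t i j ∈ _ at hN
      let M : Matrix I I (Coeff k) := .of fun i j =>
        if (o (π i) = i ∧ o (π j) = j) ∧ (π i).1 = (π j).1 then N (π i).1 (π i).2 (π j).2 else 0
      obtain ⟨x, hx⟩ : M ∈ Φ.range := by
        rw [h.mem_range]
        intro i j
        by_cases hij : (o (π i) = i ∧ o (π j) = j) ∧ (π i).1 = (π j).1
        · simp only [M, of_apply, if_pos hij]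
          exact mem_arrows.2 ⟨fun h => absurd hij.2 h, (mem_arrows.1 (hN _ _ _)).2⟩
        · simp only [M, of_apply, if_neg hij]
          exact Submodule.zero_mem _
      change Φ x = M at hx
      refine ⟨⟨x, (Subsemigroup.mem_corner_iff he).2 ⟨h.injective ?_, h.injective ?_⟩⟩, ?_⟩
      · rw [map_mul, h.map_sum_diag ho, hx]
        ext1 i j
        rw [diagonal_mul]
        by_cases hi : o (π i) = i <;> simp [M, hi]
      · rw [map_mul, h.map_sum_diag ho, hx]
        ext1 i j
        rw [mul_diagonal]
        by_cases hi : o (π j) = j <;> simp [M, hi]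
      · ext1 t; ext1 s s'
        change Φ x (o (t, s)) (o (t, s')) = _
        simp [hx, M, ho, hNdef]
  exact ⟨(AlgEquiv.ofInjective θ hθi).trans ((Subalgebra.equivOfEq _ _ hrange).trans
    (AlgEquiv.ofInjective ξ hξ).symm)⟩

end IsArrowMatrixAlgebra

end ArrowMatrix

/-! ### A spanning set of the quasi-quantum group -/

namespace Qusl2

section Span

variable {k : Type u} [Field k] (n : ℕ) (q : k)

/-- The quotient map from the free algebra. -/
def mk : FreeAlgebra k QGen →ₐ[k] Qusl2 k n q := RingQuot.mkAlgHom k (QRel n q)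

/-- The class of a generator. -/
def gen (i : QGen) : Qusl2 k n q := mk n q (FreeAlgebra.ι k i)

variable {n q} in
theorem mk_rel {a b : FreeAlgebra k QGen} (h : QRel n q a b) : mk n q a = mk n q b :=
  RingQuot.mkAlgHom_rel k h

local notation "κ" => gen n q QGen.K
local notation "κₕ" => gen n q QGen.Khat
local notation "𝐄" => gen n q QGen.E
local notation "𝐅" => gen n q QGen.F

theorem K_pow : κ ^ n = 1 := by
  have := mk_rel (QRel.K_pow (n := n) (q := q))
  rw [map_pow, map_one] at this
  exact this

theorem Khat_pow_mul : κₕ ^ n * κ ^ 2 = 1 := by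
  have := mk_rel (QRel.Khat_pow (n := n) (q := q))
  rw [map_mul, map_pow, map_pow, map_one] at this
  exact this

theorem K_mul_Khat : κ * κₕ = κₕ * κ := by
  have := mk_rel (QRel.K_Khat (n := n) (q := q))
  rw [map_mul, map_mul] at this
  exact this

theorem K_mul_E : κ * 𝐄 = q ^ n • (𝐄 * κ) := by
  have := mk_rel (QRel.K_E (n := n) (q := q))
  rw [map_mul, map_smul, map_mul] at this
  exact this

theorem K_mul_F : κ * 𝐅 = (q ^ n)⁻¹ • (𝐅 * κ) := by
  have := mk_rel (QRel.K_F (n := n) (q := q))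
  rw [map_mul, map_smul, map_mul] at this
  exact this

theorem Khat_mul_E : κₕ * 𝐄 = (q ^ n * (q ^ 2)⁻¹) • (𝐄 * κₕ) := by
  have := mk_rel (QRel.Khat_E (n := n) (q := q))
  rw [map_mul, map_smul, map_mul] at this
  exact this

theorem Khat_mul_F : κₕ * 𝐅 = ((q ^ n)⁻¹ * q ^ 2) • (𝐅 * κₕ) := by
  have := mk_rel (QRel.Khat_F (n := n) (q := q))
  rw [map_mul, map_smul, map_mul] at this
  exact this

theorem E_pow : 𝐄 ^ (n ^ 2) = 0 := by
  have := mk_rel (QRel.E_pow (n := n) (q := q))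
  rw [map_pow, map_zero] at this
  exact this

theorem F_pow : 𝐅 ^ (n ^ 2) = 0 := by
  have := mk_rel (QRel.F_pow (n := n) (q := q))
  rw [map_pow, map_zero] at this
  exact this

theorem F_mul_E : 𝐅 * 𝐄 = q⁻¹ • (𝐄 * 𝐅) + (1 - κ ^ (n - 1) * κₕ) := by
  have := mk_rel (QRel.F_E (n := n) (q := q))
  rw [map_sub, map_mul, map_smul, map_mul, map_sub, map_one, map_mul, map_pow] at this
  exact sub_eq_iff_eq_add'.1 this

theorem Khat_pow [NeZero n] : κₕ ^ n = κ ^ (2 * (n - 1)) := by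
  have hn := NeZero.one_le (n := n)
  calc κₕ ^ n = κₕ ^ n * κ ^ (2 + 2 * (n - 1)) := by
        rw [show 2 + 2 * (n - 1) = n * 2 by omega, pow_mul, K_pow, one_pow, mul_one]
    _ = κ ^ (2 * (n - 1)) := by rw [pow_add, ← mul_assoc, Khat_pow_mul, one_mul]

/-- The ordered monomials in the generators. -/
def monomial (a b i j : ℕ) : Qusl2 k n q := 𝐄 ^ a * (𝐅 ^ b * (κ ^ i * κₕ ^ j))

/-- The span of the ordered monomials with reduced exponents. -/
def monomialSpan : Submodule k (Qusl2 k n q) :=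
  Submodule.span k (Set.range fun p : (Fin (n ^ 2) × Fin (n ^ 2)) × (Fin n × Fin n) =>
    monomial n q p.1.1 p.1.2 p.2.1 p.2.2)

/-- Monomials with arbitrary exponents reduce to monomials with bounded exponents. -/
theorem monomial_mem [NeZero n] (a b i j : ℕ) : monomial n q a b i j ∈ monomialSpan n q := by
  by_cases ha : a < n ^ 2
  swap
  · rw [monomial, pow_eq_zero_of_le (not_lt.1 ha) (E_pow n q), zero_mul]
    exact Submodule.zero_mem _
  by_cases hb : b < n ^ 2
  swap
  · rw [monomial, pow_eq_zero_of_le (not_lt.1 hb) (F_pow n q), zero_mul, mul_zero]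
    exact Submodule.zero_mem _
  have hn : 0 < n := NeZero.pos n
  have key : κ ^ i * κₕ ^ j = κ ^ ((i + 2 * (n - 1) * (j / n)) % n) * κₕ ^ (j % n) := by
    rw [← pow_eq_pow_mod _ (K_pow n q), pow_add, pow_mul _ (2 * (n - 1)), ← Khat_pow, ← pow_mul,
      mul_assoc, ← pow_add, Nat.div_add_mod]
  rw [monomial, key]
  exact Submodule.subset_span ⟨((⟨a, ha⟩, ⟨b, hb⟩), (⟨_, Nat.mod_lt _ hn⟩, ⟨_, Nat.mod_lt _ hn⟩)),
    rfl⟩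

theorem mul_pow_of_mul_eq_smul {R : Type*} [Ring R] [Algebra k R] {x y : R} {c : k}
    (h : x * y = c • (y * x)) (a : ℕ) : x * y ^ a = c ^ a • (y ^ a * x) := by
  induction a with
  | zero => simp
  | succ a ih =>
    rw [pow_succ, ← mul_assoc, ih, smul_mul_assoc, mul_assoc, h, mul_smul_comm, smul_smul,
      mul_assoc, pow_succ]

theorem mul_mem_monomialSpan [NeZero n] {x : Qusl2 k n q}
    (h : ∀ a b i j, x * monomial n q a b i j ∈ monomialSpan n q) {v : Qusl2 k n q}
    (hv : v ∈ monomialSpan n q) : x * v ∈ monomialSpan n q := by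
  induction hv using Submodule.span_induction with
  | zero => simp
  | add a b _ _ ha hb => rw [mul_add]; exact Submodule.add_mem _ ha hb
  | smul c a _ ha => rw [mul_smul_comm]; exact Submodule.smul_mem _ c ha
  | mem v hv => obtain ⟨p, rfl⟩ := hv; exact h _ _ _ _

/-- The span of the ordered monomials is a left ideal. For `F` this is an induction on the exponent of
`E`, using the relation `F E = q⁻¹ E F + 1 - κ⁻¹ κ̂`. -/
theorem gen_mul_mem_monomialSpan [NeZero n] (g : QGen) {v : Qusl2 k n q}
    (hv : v ∈ monomialSpan n q) : gen n q g * v ∈ monomialSpan n q := by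
  have hE {v} (hv : v ∈ monomialSpan n q) : 𝐄 * v ∈ monomialSpan n q := by
    refine mul_mem_monomialSpan n q (fun a b i j => ?_) hv
    rw [monomial, ← mul_assoc, ← pow_succ']
    exact monomial_mem n q _ _ _ _
  have hK {v} (hv : v ∈ monomialSpan n q) : κ * v ∈ monomialSpan n q := by
    refine mul_mem_monomialSpan n q (fun a b i j => ?_) hv
    rw [monomial, ← mul_assoc, mul_pow_of_mul_eq_smul (K_mul_E n q), smul_mul_assoc, mul_assoc,
      ← mul_assoc κ, mul_pow_of_mul_eq_smul (K_mul_F n q), smul_mul_assoc, mul_smul_comm,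
      mul_assoc (_ ^ b), ← mul_assoc κ, ← pow_succ']
    exact Submodule.smul_mem _ _ (Submodule.smul_mem _ _ (monomial_mem n q _ _ _ _))
  have hK' {v} (hv : v ∈ monomialSpan n q) : κₕ * v ∈ monomialSpan n q := by
    refine mul_mem_monomialSpan n q (fun a b i j => ?_) hv
    have hc : Commute κₕ (κ ^ i) := Commute.pow_right (K_mul_Khat n q).symm i
    rw [monomial, ← mul_assoc, mul_pow_of_mul_eq_smul (Khat_mul_E n q), smul_mul_assoc, mul_assoc,
      ← mul_assoc κₕ, mul_pow_of_mul_eq_smul (Khat_mul_F n q), smul_mul_assoc, mul_smul_comm,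
      mul_assoc (_ ^ b), ← mul_assoc κₕ, hc.eq, mul_assoc (_ ^ i), ← pow_succ']
    exact Submodule.smul_mem _ _ (Submodule.smul_mem _ _ (monomial_mem n q _ _ _ _))
  have hKpow (l : ℕ) {v} (hv : v ∈ monomialSpan n q) : κ ^ l * v ∈ monomialSpan n q := by
    induction l with
    | zero => simpa using hv
    | succ l ih => rw [pow_succ', mul_assoc]; exact hK ih
  cases g with
  | E => exact hE hv
  | K => exact hK hv
  | Khat => exact hK' hv
  | F =>
    refine mul_mem_monomialSpan n q (fun a b i j => ?_) hv
    induction a with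
    | zero =>
      have : 𝐅 * monomial n q 0 b i j = monomial n q 0 (b + 1) i j := by
        rw [monomial, monomial, pow_zero, one_mul, one_mul, ← mul_assoc, ← pow_succ']
      rw [this]
      exact monomial_mem n q _ _ _ _
    | succ a ih =>
      have hm := monomial_mem n q a b i j
      have : 𝐅 * monomial n q (a + 1) b i j = q⁻¹ • (𝐄 * (𝐅 * monomial n q a b i j)) +
          (monomial n q a b i j - κ ^ (n - 1) * (κₕ * monomial n q a b i j)) := by
        have h1 : monomial n q (a + 1) b i j = 𝐄 * monomial n q a b i j := by
          rw [monomial, monomial, pow_succ', mul_assoc]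
        rw [h1, ← mul_assoc, F_mul_E, add_mul, sub_mul, one_mul, smul_mul_assoc, mul_assoc,
          mul_assoc]
      rw [this]
      exact Submodule.add_mem _ (Submodule.smul_mem _ _ (hE ih))
        (Submodule.sub_mem _ hm (hKpow _ (hK' hm)))

theorem mk_surjective : Function.Surjective (mk n q) :=
  RingQuot.mkAlgHom_surjective k (QRel n q)

theorem monomialSpan_eq_top [NeZero n] : monomialSpan n q = ⊤ := by
  have hall (a : FreeAlgebra k QGen) : ∀ v ∈ monomialSpan n q,
      mk n q a * v ∈ monomialSpan n q := by
    induction a using FreeAlgebra.induction with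
    | grade0 c =>
      intro v hv
      rw [AlgHom.commutes, ← Algebra.smul_def]
      exact Submodule.smul_mem _ c hv
    | grade1 i => exact fun v hv => gen_mul_mem_monomialSpan n q i hv
    | mul a b ha hb =>
      intro v hv
      rw [map_mul, mul_assoc]
      exact ha _ (hb _ hv)
    | add a b ha hb =>
      intro v hv
      rw [map_add, add_mul]
      exact Submodule.add_mem _ (ha _ hv) (hb _ hv)
  rw [eq_top_iff]
  intro a _
  obtain ⟨a, rfl⟩ := mk_surjective n q a
  have h1 : (1 : Qusl2 k n q) ∈ monomialSpan n q := by
    have := monomial_mem n q 0 0 0 0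
    simpa [monomial] using this
  have := hall a 1 h1
  rwa [mul_one] at this

instance [NeZero n] : Module.Finite k (Qusl2 k n q) :=
  ⟨⟨Set.finite_range _ |>.toFinset, by
    rw [Set.Finite.coe_toFinset]
    exact monomialSpan_eq_top n q⟩⟩

/-- The `n⁶` ordered monomials span the algebra, so its dimension is at most `n⁶`. -/
theorem finrank_le [NeZero n] : Module.finrank k (Qusl2 k n q) ≤ n ^ 2 * n ^ 2 * n ^ 2 := by
  rw [← finrank_top k, ← monomialSpan_eq_top n q]
  refine (finrank_range_le_card _).trans (le_of_eq ?_)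
  simp only [Fintype.card_prod, Fintype.card_fin]
  ring

end Span

end Qusl2

/-! ### Weighted permutation matrices -/

section WeightedPerm

variable {I R : Type*} [Fintype I] [DecidableEq I] [CommRing R]

/-- The matrix sending the basis vector at `j` to `e j` times the basis vector at `σ j`. -/
def weightedPerm (σ : Equiv.Perm I) (e : I → R) : Matrix I I R :=
  .of fun i j => if i = σ j then e j else 0

theorem weightedPerm_apply (σ : Equiv.Perm I) (e : I → R) (i j : I) :
    weightedPerm σ e i j = if i = σ j then e j else 0 := rfl

theorem weightedPerm_mul (σ τ : Equiv.Perm I) (e f : I → R) :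
    weightedPerm σ e * weightedPerm τ f = weightedPerm (σ * τ) fun j => e (τ j) * f j := by
  ext i j
  rw [Matrix.mul_apply, Finset.sum_eq_single (τ j)]
  · change (if i = σ (τ j) then e (τ j) else 0) * (if τ j = τ j then f j else 0) =
      if i = σ (τ j) then e (τ j) * f j else 0
    rw [if_pos rfl, ite_mul, zero_mul]
  · intro l _ hl
    simp [weightedPerm_apply, hl]
  · simp

theorem weightedPerm_one (e : I → R) : weightedPerm 1 e = Matrix.diagonal e := by
  ext i j
  by_cases h : i = j
  · subst h; simp [weightedPerm_apply]
  · simp [weightedPerm_apply, h]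

theorem weightedPerm_pow (σ : Equiv.Perm I) (e : I → R) (m : ℕ) :
    weightedPerm σ e ^ m = weightedPerm (σ ^ m) fun j => ∏ l ∈ Finset.range m, e ((σ ^ l) j) := by
  induction m with
  | zero => simp [weightedPerm_one]
  | succ m ih =>
    rw [pow_succ', ih, weightedPerm_mul, ← pow_succ']
    congr 1
    ext j
    rw [Finset.prod_range_succ, mul_comm]

theorem weightedPerm_smul {k : Type*} [CommRing k] [Algebra k R] (c : k) (σ : Equiv.Perm I)
    (e : I → R) : c • weightedPerm σ e = weightedPerm σ (c • e) := by
  ext i j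
  simp [weightedPerm_apply]

theorem weightedPerm_zero (σ : Equiv.Perm I) : weightedPerm σ (0 : I → R) = 0 := by
  ext i j
  simp [weightedPerm_apply]

theorem prod_eq_zero_of_mul_eq_zero {ι : Type*} {s : Finset ι} {g : ι → R} {i j : ι} (hi : i ∈ s)
    (hj : j ∈ s) (hij : i ≠ j) (h : g i * g j = 0) : ∏ l ∈ s, g l = 0 := by
  classical
  have : ∏ l ∈ {i, j}, g l ∣ ∏ l ∈ s, g l :=
    Finset.prod_dvd_prod_of_subset _ _ _ (by simp [Finset.insert_subset_iff, hi, hj])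
  rw [Finset.prod_pair hij, h] at this
  exact zero_dvd_iff.1 this

end WeightedPerm

/-! ### The representation on the weight lattice -/

namespace Qusl2

section Representation

open Coeff

/-- The set of blocks. The block `(c, ε)` contains the two simple modules of dimensions `2c + 1` and
`n² - 2c - 1`. -/
abbrev Block (n : ℕ) : Type := Fin (n ^ 2 / 4) × ℤˣ

/-- Pairs consisting of a block and a weight. -/
abbrev Index (n : ℕ) : Type := Block n × ZMod (n ^ 2)

variable {k : Type u} [Field k] {n : ℕ} [NeZero n] {q : k} (hq : IsPrimitiveRoot q (n ^ 2))

/-- The character `b ↦ q ^ b` of `ZMod (n²)`. -/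
def qpow : AddChar (ZMod (n ^ 2)) k := AddChar.zmodChar (n ^ 2) hq.pow_eq_one

theorem qpow_one : qpow hq 1 = q := by
  have := AddChar.zmodChar_apply' hq.pow_eq_one 1
  rwa [Nat.cast_one, pow_one] at this

theorem qpow_add_one (b : ZMod (n ^ 2)) : qpow hq (b + 1) = q * qpow hq b := by
  rw [AddChar.map_add_eq_mul, qpow_one, mul_comm]

theorem qpow_ne_zero (b : ZMod (n ^ 2)) : qpow hq b ≠ 0 := by
  intro h
  have := AddChar.map_add_eq_mul (qpow hq) b (-b)
  simp [h] at this

theorem qpow_injective : Function.Injective (qpow hq) := by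
  intro a b hab
  rw [qpow, AddChar.zmodChar_apply, AddChar.zmodChar_apply] at hab
  exact ZMod.val_injective _ (hq.pow_inj (ZMod.val_lt a) (ZMod.val_lt b) hab)

theorem qpow_pow (b : ZMod (n ^ 2)) : qpow hq b ^ (n ^ 2) = 1 := by
  rw [← AddChar.map_nsmul_eq_pow]
  simp

/-- The two weights of a block after which one simple module ends and the other one begins. -/
def IsCrossing (c : Fin (n ^ 2 / 4)) (b : ZMod (n ^ 2)) : Prop :=
  b = (c.val : ZMod (n ^ 2)) ∨ b = -1 - (c.val : ZMod (n ^ 2))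

instance (c : Fin (n ^ 2 / 4)) (b : ZMod (n ^ 2)) : Decidable (IsCrossing c b) :=
  inferInstanceAs (Decidable (_ ∨ _))

/-- The function `b ↦ q ^ (b + 1) + q ^ (-b)`, through which the Casimir element acts. -/
def casimir (b : ZMod (n ^ 2)) : k := q * qpow hq b + (qpow hq b)⁻¹

/-- The normalizing factor `q ^ (-b) / (q - 1)`. -/
def normFactor (b : ZMod (n ^ 2)) : k := (qpow hq b)⁻¹ * (q - 1)⁻¹

/-- The matrix coefficient of `E` from weight `b` to weight `b + 1`. -/
def eCoeff (i : Index n) : Coeff k := if IsCrossing i.1.1 i.2 then X else 1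

/-- The diagonal matrix coefficient of `F E` at weight `b`. -/
def feCoeff (i : Index n) : Coeff k :=
  Coeff.mk (normFactor hq i.2 * (casimir hq i.2 - casimir hq (i.1.1.val : ZMod (n ^ 2)))) 0 0
    (normFactor hq i.2)

/-- The matrix coefficient of `F` from weight `b + 1` to weight `b`. -/
def fCoeff (i : Index n) : Coeff k :=
  if IsCrossing i.1.1 i.2 then normFactor hq i.2 • Y else feCoeff hq i

/-- The eigenvalue of `κ`. -/
def kCoeff (i : Index n) : k := ((i.1.2 : ℤ) : k) * qpow hq i.2 ^ n

/-- The eigenvalue of `κ̂`. -/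
def khatCoeff (i : Index n) : k := ((i.1.2 : ℤ) : k) * (qpow hq i.2 ^ n * (qpow hq i.2 ^ 2)⁻¹)

theorem casimir_eq_iff {a b : ZMod (n ^ 2)} :
    casimir hq a = casimir hq b ↔ a = b ∨ a = -1 - b := by
  have ha := qpow_ne_zero hq a
  have hb := qpow_ne_zero hq b
  have key : casimir hq a - casimir hq b =
      (qpow hq a - qpow hq b) * (qpow hq (a + 1 + b) - 1) * (qpow hq a * qpow hq b)⁻¹ := by
    rw [AddChar.map_add_eq_mul, qpow_add_one, casimir, casimir]
    field_simp
    ring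
  have h0 : qpow hq 0 = 1 := AddChar.map_zero_eq_one _
  rw [← sub_eq_zero, key, mul_eq_zero, mul_eq_zero, sub_eq_zero, sub_eq_zero, ← h0,
    (qpow_injective hq).eq_iff, (qpow_injective hq).eq_iff]
  simp only [inv_eq_zero, mul_eq_zero, ha, hb, or_self, or_false]
  refine or_congr_right ⟨fun h => ?_, fun h => ?_⟩
  · linear_combination h
  · linear_combination h

theorem isCrossing_iff {c : Fin (n ^ 2 / 4)} {b : ZMod (n ^ 2)} :
    IsCrossing c b ↔ casimir hq b = casimir hq (c.val : ZMod (n ^ 2)) :=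
  (casimir_eq_iff hq).symm

/-- At a crossing the constant term of `feCoeff` vanishes, and the product `y x` accounts for the
remaining multiple of `xy`. -/
theorem fCoeff_mul_eCoeff (i : Index n) : fCoeff hq i * eCoeff i = feCoeff hq i := by
  by_cases h : IsCrossing i.1.1 i.2
  · rw [fCoeff, eCoeff, if_pos h, if_pos h, feCoeff, (isCrossing_iff hq).1 h, smul_mul_assoc,
      Y_mul_X]
    ext <;> simp [W]
  · rw [fCoeff, eCoeff, if_neg h, if_neg h, mul_one]

theorem sign_mul_self (ε : ℤˣ) : ((ε : ℤ) : k) * ((ε : ℤ) : k) = 1 := by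
  rw [← Int.cast_mul, Int.units_coe_mul_self, Int.cast_one]

theorem sign_pow_even (ε : ℤˣ) {m : ℕ} (hm : Even m) : ((ε : ℤ) : k) ^ m = 1 := by
  obtain ⟨l, rfl⟩ := hm
  rw [← two_mul, pow_mul, pow_two, sign_mul_self, one_pow]

theorem kCoeff_pow (hn : Even n) (i : Index n) : kCoeff hq i ^ n = 1 := by
  rw [kCoeff, mul_pow, sign_pow_even _ hn, ← pow_mul, ← pow_two, qpow_pow, one_mul]

theorem khatCoeff_pow (hn : Even n) (i : Index n) : khatCoeff hq i ^ n * kCoeff hq i ^ 2 = 1 := by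
  have := qpow_ne_zero hq i.2
  rw [khatCoeff, mul_pow, sign_pow_even _ hn, kCoeff, mul_pow _ _ 2, sign_pow_even _ even_two,
    mul_pow, ← pow_mul (qpow hq i.2) n n, ← pow_two, qpow_pow, inv_pow, ← pow_mul, ← pow_mul,
    mul_comm 2 n]
  field_simp

theorem kCoeff_pow_mul_khatCoeff (hn : Even n) (i : Index n) :
    kCoeff hq i ^ (n - 1) * khatCoeff hq i = (qpow hq i.2 ^ 2)⁻¹ := by
  have h1 : khatCoeff hq i = kCoeff hq i * (qpow hq i.2 ^ 2)⁻¹ := by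
    rw [khatCoeff, kCoeff, mul_assoc]
  rw [h1, ← mul_assoc, ← pow_succ, Nat.sub_add_cancel (NeZero.one_le), kCoeff_pow hq hn, one_mul]

/-- The defining relation between `E` and `F`, on matrix coefficients. -/
theorem feCoeff_sub (hq1 : q ≠ 1) (t : Block n) (b : ZMod (n ^ 2)) :
    feCoeff hq (t, b + 1) - q⁻¹ • feCoeff hq (t, b) =
      1 - algebraMap k _ (qpow hq (b + 1) ^ 2)⁻¹ := by
  have hq0 : q ≠ 0 := hq.ne_zero (NeZero.ne _)
  have hb := qpow_ne_zero hq b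
  have hq1' : q - 1 ≠ 0 := sub_ne_zero.2 hq1
  ext <;> simp [feCoeff, normFactor, casimir, qpow_add_one] <;> field_simp <;> ring

/-- The two crossings of a block are different, because `n²` is even. -/
theorem natCast_ne_neg_one_sub (hn : Even n) (c : ℕ) :
    (c : ZMod (n ^ 2)) ≠ -1 - (c : ZMod (n ^ 2)) := by
  intro h
  have : ((2 * c + 1 : ℕ) : ZMod (n ^ 2)) = 0 := by
    push_cast
    linear_combination h
  rw [ZMod.natCast_eq_zero_iff] at this
  have h2 : 2 ∣ 2 * c + 1 := (hn.two_dvd.trans (dvd_pow_self n two_ne_zero)).trans this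
  omega

/-- The shift of weights by one. -/
def shift : Equiv.Perm (Index n) := Equiv.prodCongr (Equiv.refl _) (Equiv.addRight 1)

theorem shift_apply (t : Block n) (b : ZMod (n ^ 2)) : shift (t, b) = (t, b + 1) := rfl

theorem shift_inv_apply (t : Block n) (b : ZMod (n ^ 2)) : shift⁻¹ (t, b) = (t, b - 1) := by
  rw [Equiv.Perm.inv_eq_iff_eq, shift_apply, sub_add_cancel]

theorem shift_pow_apply (l : ℕ) (t : Block n) (b : ZMod (n ^ 2)) :
    (shift ^ l) (t, b) = (t, b + l) := by
  induction l with
  | zero => simp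
  | succ l ih => rw [pow_succ', Equiv.Perm.mul_apply, ih, shift_apply]; push_cast; rw [add_assoc]

theorem shift_inv_pow_apply (l : ℕ) (t : Block n) (b : ZMod (n ^ 2)) :
    (shift⁻¹ ^ l) (t, b) = (t, b - l) := by
  rw [inv_pow, Equiv.Perm.inv_eq_iff_eq, shift_pow_apply, sub_add_cancel]

/-- The matrices of the generators. -/
def genMatrix : QGen → Matrix (Index n) (Index n) (Coeff k)
  | .K => weightedPerm 1 fun i => algebraMap k _ (kCoeff hq i)
  | .Khat => weightedPerm 1 fun i => algebraMap k _ (khatCoeff hq i)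
  | .E => weightedPerm shift eCoeff
  | .F => weightedPerm shift⁻¹ fun i => fCoeff hq (shift⁻¹ i)

theorem genMatrix_F_mul_E :
    genMatrix hq .F * genMatrix hq .E = Matrix.diagonal (feCoeff hq) := by
  rw [genMatrix, genMatrix, weightedPerm_mul, inv_mul_cancel, weightedPerm_one]
  congr 1
  ext1 i
  rw [show shift⁻¹ (shift i) = i from shift.symm_apply_apply i, fCoeff_mul_eCoeff]

/-- Going once around the cycle of weights meets both crossings of the block, and `x² = 0`. -/
theorem genMatrix_E_pow (hn : Even n) : genMatrix hq .E ^ (n ^ 2) = 0 := by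
  rw [genMatrix, weightedPerm_pow]
  refine Eq.trans (congrArg _ ?_) (weightedPerm_zero (shift ^ n ^ 2))
  ext1 ⟨t, b⟩
  refine prod_eq_zero_of_mul_eq_zero (i := ((t.1.val : ZMod (n ^ 2)) - b).val)
    (j := (-1 - (t.1.val : ZMod (n ^ 2)) - b).val) (Finset.mem_range.2 (ZMod.val_lt _))
    (Finset.mem_range.2 (ZMod.val_lt _)) ?_ ?_
  · intro h
    have := ZMod.val_injective _ h
    exact natCast_ne_neg_one_sub hn _ (sub_left_inj.1 this)
  · rw [shift_pow_apply, shift_pow_apply, ZMod.natCast_zmod_val, ZMod.natCast_zmod_val,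
      add_sub_cancel, add_sub_cancel, eCoeff, eCoeff, if_pos (by exact Or.inl rfl),
      if_pos (by exact Or.inr rfl), X_mul_X]

/-- Going once around the cycle of weights meets both crossings of the block, and `y² = 0`. -/
theorem genMatrix_F_pow (hn : Even n) : genMatrix hq .F ^ (n ^ 2) = 0 := by
  rw [genMatrix, weightedPerm_pow]
  refine Eq.trans (congrArg _ ?_) (weightedPerm_zero (shift⁻¹ ^ n ^ 2))
  ext1 ⟨t, b⟩
  refine prod_eq_zero_of_mul_eq_zero (i := (b - 1 - (t.1.val : ZMod (n ^ 2))).val)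
    (j := (b - 1 - (-1 - (t.1.val : ZMod (n ^ 2)))).val) (Finset.mem_range.2 (ZMod.val_lt _))
    (Finset.mem_range.2 (ZMod.val_lt _)) ?_ ?_
  · intro h
    have := ZMod.val_injective _ h
    exact natCast_ne_neg_one_sub hn _ (sub_right_inj.1 this)
  · have h1 (a : ZMod (n ^ 2)) : b - (b - 1 - a) - 1 = a := by ring
    rw [shift_inv_pow_apply, shift_inv_pow_apply, ZMod.natCast_zmod_val, ZMod.natCast_zmod_val,
      shift_inv_apply, shift_inv_apply, h1, h1, fCoeff, fCoeff, if_pos (by exact Or.inl rfl),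
      if_pos (by exact Or.inr rfl), smul_mul_smul_comm, Y_mul_Y, smul_zero]

theorem ne_one_of_even {q : k} (hq : IsPrimitiveRoot q (n ^ 2)) (hn : Even n) : q ≠ 1 := by
  rintro rfl
  have h1 := hq.unique IsPrimitiveRoot.one
  have : n = 1 := by simpa using h1
  subst this
  exact absurd hn (by decide)

theorem genMatrix_rel (hn : Even n) {a b : FreeAlgebra k QGen} (h : QRel n q a b) :
    FreeAlgebra.lift k (genMatrix hq) a = FreeAlgebra.lift k (genMatrix hq) b := by
  have hq0 : q ≠ 0 := hq.ne_zero (NeZero.ne _)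
  have hq1 : q ≠ 1 := ne_one_of_even hq hn
  cases h with
  | K_pow =>
    simp only [map_pow, FreeAlgebra.lift_ι_apply, map_one, genMatrix, weightedPerm_one,
      Matrix.diagonal_pow]
    rw [← Matrix.diagonal_one]
    congr 1
    ext1 i
    rw [Pi.pow_apply, ← map_pow, kCoeff_pow hq hn, map_one]
  | Khat_pow =>
    simp only [map_mul, map_pow, FreeAlgebra.lift_ι_apply, map_one, genMatrix, weightedPerm_one,
      Matrix.diagonal_pow, Matrix.diagonal_mul_diagonal]
    rw [← Matrix.diagonal_one]
    congr 1
    ext1 i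
    rw [Pi.pow_apply, Pi.pow_apply, ← map_pow, ← map_pow, ← map_mul, khatCoeff_pow hq hn, map_one]
  | K_Khat =>
    simp only [map_mul, FreeAlgebra.lift_ι_apply, genMatrix, weightedPerm_one,
      Matrix.diagonal_mul_diagonal]
    congr 1
    ext1 i
    rw [mul_comm]
  | K_E =>
    simp only [map_mul, map_smul, FreeAlgebra.lift_ι_apply, genMatrix, weightedPerm_mul,
      weightedPerm_smul, mul_one, one_mul]
    congr 1
    ext1 ⟨t, b⟩
    have : kCoeff hq (t, b + 1) = q ^ n * kCoeff hq (t, b) := by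
      rw [kCoeff, kCoeff, qpow_add_one]; ring
    rw [shift_apply, this, Pi.smul_apply, Algebra.smul_def, map_mul]
    simp only [Equiv.Perm.one_apply]
    ring
  | K_F =>
    simp only [map_mul, map_smul, FreeAlgebra.lift_ι_apply, genMatrix, weightedPerm_mul,
      weightedPerm_smul, mul_one, one_mul]
    congr 1
    ext1 ⟨t, b⟩
    have : kCoeff hq (t, b - 1) = (q ^ n)⁻¹ * kCoeff hq (t, b) := by
      obtain ⟨b, rfl⟩ : ∃ b', b = b' + 1 := ⟨b - 1, by ring⟩
      rw [kCoeff, kCoeff, qpow_add_one, add_sub_cancel_right, mul_pow]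
      field_simp
    simp only [Equiv.Perm.one_apply, shift_inv_apply, Pi.smul_apply]
    rw [this, Algebra.smul_def, map_mul]
    ring
  | Khat_E =>
    simp only [map_mul, map_smul, FreeAlgebra.lift_ι_apply, genMatrix, weightedPerm_mul,
      weightedPerm_smul, mul_one, one_mul]
    congr 1
    ext1 ⟨t, b⟩
    have : khatCoeff hq (t, b + 1) = (q ^ n * (q ^ 2)⁻¹) * khatCoeff hq (t, b) := by
      rw [khatCoeff, khatCoeff, qpow_add_one, mul_pow, mul_pow, mul_inv]; ring
    simp only [Equiv.Perm.one_apply, shift_apply, Pi.smul_apply]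
    rw [this, Algebra.smul_def, map_mul]
    ring
  | Khat_F =>
    simp only [map_mul, map_smul, FreeAlgebra.lift_ι_apply, genMatrix, weightedPerm_mul,
      weightedPerm_smul, mul_one, one_mul]
    congr 1
    ext1 ⟨t, b⟩
    have : khatCoeff hq (t, b - 1) = ((q ^ n)⁻¹ * q ^ 2) * khatCoeff hq (t, b) := by
      obtain ⟨b, rfl⟩ : ∃ b', b = b' + 1 := ⟨b - 1, by ring⟩
      rw [khatCoeff, khatCoeff, qpow_add_one, add_sub_cancel_right, mul_pow, mul_pow, mul_inv]
      field_simp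
    simp only [Equiv.Perm.one_apply, shift_inv_apply, Pi.smul_apply]
    rw [this, Algebra.smul_def, map_mul]
    ring
  | E_pow => rw [map_pow, FreeAlgebra.lift_ι_apply, genMatrix_E_pow hq hn, map_zero]
  | F_pow => rw [map_pow, FreeAlgebra.lift_ι_apply, genMatrix_F_pow hq hn, map_zero]
  | F_E =>
    simp only [map_sub, map_mul, map_smul, map_one, map_pow, FreeAlgebra.lift_ι_apply]
    rw [genMatrix_F_mul_E]
    simp only [genMatrix, weightedPerm_mul, mul_inv_cancel, weightedPerm_one, Matrix.diagonal_pow,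
      Matrix.diagonal_mul_diagonal, ← Matrix.diagonal_smul, Matrix.diagonal_sub]
    rw [← Matrix.diagonal_one, Matrix.diagonal_sub]
    congr 1
    ext1 ⟨t, b⟩
    obtain ⟨b, rfl⟩ : ∃ b', b = b' + 1 := ⟨b - 1, by ring⟩
    rw [Pi.smul_apply, mul_comm (eCoeff _), fCoeff_mul_eCoeff, Pi.pow_apply, ← map_pow, ← map_mul,
      kCoeff_pow_mul_khatCoeff hq hn, shift_inv_apply, add_sub_cancel_right, feCoeff_sub hq hq1]

/-- The representation of the quasi-quantum group by matrices over `k[x, y] / (x², y²)`. -/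
def rep (hn : Even n) : Qusl2 k n q →ₐ[k] Matrix (Index n) (Index n) (Coeff k) :=
  RingQuot.liftAlgHom k ⟨FreeAlgebra.lift k (genMatrix hq), fun _ _ h => genMatrix_rel hq hn h⟩

theorem rep_gen (hn : Even n) (g : QGen) : rep hq hn (gen n q g) = genMatrix hq g :=
  (RingQuot.liftAlgHom_mkAlgHom_apply k _ _ _).trans (FreeAlgebra.lift_ι_apply _ _)

end Representation

end Qusl2

/-! ### The image of the representation -/

section Separation

open Coeff

variable {k : Type u} [Field k]

variable (k) in
/-- The subalgebra `k1 + kxy` of even elements. -/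
def evenCoeff : Subalgebra k (Coeff k) where
  carrier := {z | cx z = 0 ∧ cy z = 0}
  mul_mem' := by rintro a b ⟨ha, ha'⟩ ⟨hb, hb'⟩; simp [*]
  add_mem' := by rintro a b ⟨ha, ha'⟩ ⟨hb, hb'⟩; simp [*]
  algebraMap_mem' r := by simp

theorem mem_evenCoeff {z : Coeff k} : z ∈ evenCoeff k ↔ cx z = 0 ∧ cy z = 0 := Iff.rfl

/-- A subalgebra of functions with values in `k[x, y] / (x², y²)` that contains even functions
separating `i` from all other points modulo the radical contains the indicator function of `i`. -/
theorem single_mem_of_separates {I : Type*} [Fintype I] [DecidableEq I]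
    (D : Subalgebra k (I → Coeff k)) (i : I)
    (hsep : ∀ j, j ≠ i → ∃ d ∈ D, (∀ l, d l ∈ evenCoeff k) ∧ c1 (d j) ≠ c1 (d i)) :
    Pi.single i 1 ∈ D := by
  have hp : ∀ j, ∃ p ∈ D, (∀ l, p l ∈ evenCoeff k) ∧ (j ≠ i → p j = 0) ∧ c1 (p i) ≠ 0 := by
    intro j
    by_cases hj : j = i
    · exact ⟨1, one_mem _, fun l => one_mem _, fun h => absurd hj h, by simp⟩
    · obtain ⟨d, hd, he, hne⟩ := hsep j hj
      have hs : d - algebraMap k _ (c1 (d j)) ∈ D := sub_mem hd (algebraMap_mem _ _)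
      refine ⟨(d - algebraMap k _ (c1 (d j))) ^ 2, pow_mem hs 2, fun l => ?_, fun _ => ?_, ?_⟩
      · exact pow_mem (sub_mem (he l) (algebraMap_mem _ _)) 2
      · have := mem_evenCoeff.1 (he j)
        ext <;> simp [pow_two, this]
      · simpa [pow_two, sub_eq_zero] using hne.symm
  choose p hpD hpe hp0 hpi using hp
  have hP : ∏ j, p j ∈ D := prod_mem fun j _ => hpD j
  set P := ∏ j, p j with hPdef
  have hPi : P i ∈ evenCoeff k := by
    rw [hPdef, Finset.prod_apply]
    exact prod_mem fun j _ => hpe j i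
  have hPi1 : c1 (P i) ≠ 0 := by
    rw [hPdef, Finset.prod_apply, ← c1Hom_apply, map_prod]
    exact Finset.prod_ne_zero_iff.2 fun j _ => hpi j
  have hP0 (j : I) (hj : j ≠ i) : P j = 0 := by
    rw [hPdef, Finset.prod_apply]
    exact Finset.prod_eq_zero (Finset.mem_univ j) (hp0 j hj)
  -- The polynomial `2 z / r - z² / r²` takes the value `1` at `z = r + s xy`.
  have : Pi.single i 1 = (2 * (c1 (P i))⁻¹) • P - ((c1 (P i))⁻¹ ^ 2) • (P * P) := by
    ext1 j
    by_cases hj : j = i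
    · subst hj
      have := mem_evenCoeff.1 hPi
      ext <;> simp [this] <;> field_simp <;> ring
    · simp [hj, hP0 j hj]
  rw [this]
  exact sub_mem (D.smul_mem hP _) (D.smul_mem (mul_mem hP hP) _)

end Separation

namespace Qusl2

section Image

open Coeff Matrix

variable {k : Type u} [Field k] {n : ℕ} [NeZero n] {q : k} (hq : IsPrimitiveRoot q (n ^ 2))

/-- The vertex of an index: its block, and which of the two simple modules of the block the weight
vector belongs to. -/
def vertex (i : Index n) : Block n × Bool :=
  (i.1, decide ((i.2 + (i.1.1.val : ZMod (n ^ 2))).val ≤ 2 * i.1.1.val))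

/-- The index of the lowest weight vector of a simple module. -/
def lowest (v : Block n × Bool) : Index n :=
  (v.1, if v.2 then -(v.1.1.val : ZMod (n ^ 2)) else (v.1.1.val : ZMod (n ^ 2)) + 1)

theorem four_mul_lt (c : Fin (n ^ 2 / 4)) : 4 * c.val + 3 < n ^ 2 := by
  have := c.2
  omega

theorem vertex_eq_true {t : Block n} {m : ℕ} (hm : m ≤ 2 * t.1.val) :
    vertex (t, -(t.1.val : ZMod (n ^ 2)) + m) = (t, true) := by
  have := four_mul_lt t.1
  rw [vertex, neg_add_cancel_comm, ZMod.val_natCast_of_lt (by omega)]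
  simp [hm]

theorem vertex_eq_false {t : Block n} {m : ℕ} (hm : m + (2 * t.1.val + 1) < n ^ 2) :
    vertex (t, (t.1.val : ZMod (n ^ 2)) + 1 + m) = (t, false) := by
  have h1 : (t.1.val : ZMod (n ^ 2)) + 1 + (m : ZMod (n ^ 2)) + (t.1.val : ZMod (n ^ 2)) =
      ((m + (2 * t.1.val + 1) : ℕ) : ZMod (n ^ 2)) := by
    push_cast; ring
  rw [vertex, h1, ZMod.val_natCast_of_lt hm]
  simp
  omega

theorem vertex_lowest (v : Block n × Bool) : vertex (lowest v) = v := by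
  obtain ⟨t, s⟩ := v
  have := four_mul_lt t.1
  cases s
  · simpa [lowest] using vertex_eq_false (t := t) (m := 0) (by omega)
  · simpa [lowest] using vertex_eq_true (t := t) (m := 0) (by omega)

theorem natCast_eq_iff_of_lt {a b : ℕ} (ha : a < n ^ 2) (hb : b < n ^ 2) :
    (a : ZMod (n ^ 2)) = b ↔ a = b := by
  rw [ZMod.natCast_eq_natCast_iff', Nat.mod_eq_of_lt ha, Nat.mod_eq_of_lt hb]

/-- The values of `casimir` separate the first components of the blocks. -/
theorem casimir_natCast_injective {c c' : Fin (n ^ 2 / 4)}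
    (h : casimir hq (c.val : ZMod (n ^ 2)) = casimir hq (c'.val : ZMod (n ^ 2))) : c = c' := by
  have h1 := four_mul_lt c
  have h2 := four_mul_lt c'
  rcases (casimir_eq_iff hq).1 h with h | h
  · exact Fin.ext ((natCast_eq_iff_of_lt (by omega) (by omega)).1 h)
  · have : ((c.val + c'.val + 1 : ℕ) : ZMod (n ^ 2)) = (0 : ℕ) := by
      push_cast
      linear_combination h
    rw [natCast_eq_iff_of_lt (by omega) (by omega)] at this
    omega

/-- The value of `casimir` at `c' + n² / 2` is minus the value at `c'`, and `c < n² / 4` is neither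
`c' + n² / 2` nor `-1 - c' - n² / 2`. -/
theorem casimir_natCast_ne_neg (hn : Even n) (c c' : Fin (n ^ 2 / 4)) :
    casimir hq (c.val : ZMod (n ^ 2)) ≠ -casimir hq (c'.val : ZMod (n ^ 2)) := by
  have h1 := four_mul_lt c
  have h2 := four_mul_lt c'
  have h4 : 4 ∣ n ^ 2 := by
    obtain ⟨m, rfl⟩ := hn.two_dvd
    exact ⟨m ^ 2, by ring⟩
  have hM : qpow hq ((n ^ 2 / 2 : ℕ) : ZMod (n ^ 2)) = -1 := by
    have hsq : qpow hq ((n ^ 2 / 2 : ℕ) : ZMod (n ^ 2)) ^ 2 = 1 := by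
      rw [← AddChar.map_nsmul_eq_pow, nsmul_eq_mul, ← Nat.cast_mul,
        show 2 * (n ^ 2 / 2) = n ^ 2 by omega, ZMod.natCast_self, AddChar.map_zero_eq_one]
    refine (mul_self_eq_one_iff.1 ((pow_two _).symm.trans hsq)).resolve_left fun h => ?_
    have h0 : qpow hq ((n ^ 2 / 2 : ℕ) : ZMod (n ^ 2)) = qpow hq (0 : ℕ) := by
      rw [h, Nat.cast_zero, AddChar.map_zero_eq_one]
    have := qpow_injective hq h0
    rw [natCast_eq_iff_of_lt (by omega) (by omega)] at this
    omega
  have hs : -casimir hq (c'.val : ZMod (n ^ 2)) =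
      casimir hq ((c'.val : ZMod (n ^ 2)) + (n ^ 2 / 2 : ℕ)) := by
    rw [casimir, casimir, AddChar.map_add_eq_mul, hM]
    simp only [mul_neg, mul_one, inv_neg]
    ring
  rw [hs, Ne, casimir_eq_iff]
  rintro (h | h)
  · rw [← Nat.cast_add, natCast_eq_iff_of_lt (by omega) (by omega)] at h
    omega
  · have : ((c.val + c'.val + 1 + n ^ 2 / 2 : ℕ) : ZMod (n ^ 2)) = (0 : ℕ) := by
      rw [Nat.cast_add]
      push_cast
      linear_combination h
    rw [natCast_eq_iff_of_lt (by omega) (by omega)] at this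
    omega

theorem kCoeff_ne_zero [CharZero k] (i : Index n) : kCoeff hq i ≠ 0 :=
  mul_ne_zero (by simp) (pow_ne_zero _ (qpow_ne_zero hq _))

theorem normFactor_ne_zero (hn : Even n) (b : ZMod (n ^ 2)) : normFactor hq b ≠ 0 :=
  mul_ne_zero (inv_ne_zero (qpow_ne_zero hq b)) (inv_ne_zero (sub_ne_zero.2 (ne_one_of_even hq hn)))

/-- The eigenvalues of `κ`, `κ̂` and `F E` determine the index. -/
theorem index_ext [CharZero k] (hn : Even n) {i j : Index n} (hk : kCoeff hq i = kCoeff hq j)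
    (hk' : khatCoeff hq i = khatCoeff hq j) (hfe : c1 (feCoeff hq i) = c1 (feCoeff hq j)) :
    i = j := by
  obtain ⟨⟨c, ε⟩, b⟩ := i
  obtain ⟨⟨c', ε'⟩, b'⟩ := j
  have hb := qpow_ne_zero hq b
  have hb' := qpow_ne_zero hq b'
  have hq1 : q - 1 ≠ 0 := sub_ne_zero.2 (ne_one_of_even hq hn)
  have hh (i : Index n) : khatCoeff hq i = kCoeff hq i * (qpow hq i.2 ^ 2)⁻¹ := by
    rw [khatCoeff, kCoeff, mul_assoc]
  rw [hh, hh, hk] at hk'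
  have hsq : qpow hq b ^ 2 = qpow hq b' ^ 2 :=
    inv_injective (mul_left_cancel₀ (kCoeff_ne_zero hq _) hk')
  have hbn : qpow hq b ^ n = qpow hq b' ^ n := by
    obtain ⟨m, rfl⟩ := hn.two_dvd
    rw [pow_mul, pow_mul, hsq]
  simp only [kCoeff, hbn] at hk
  have hε : ε = ε' := Units.ext (Int.cast_injective
    (mul_right_cancel₀ (pow_ne_zero n hb') hk))
  subst hε
  simp only [feCoeff, c1_mk] at hfe
  rcases sq_eq_sq_iff_eq_or_eq_neg.1 hsq with h | h
  · have := qpow_injective hq h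
    subst this
    have := mul_left_cancel₀ (normFactor_ne_zero hq hn b) hfe
    rw [casimir_natCast_injective hq (sub_right_inj.1 this)]
  · exfalso
    refine casimir_natCast_ne_neg hq hn c c' ?_
    have h1 : normFactor hq b = -normFactor hq b' := by
      rw [normFactor, normFactor, h, inv_neg, neg_mul]
    have h2 : casimir hq b = -casimir hq b' := by
      rw [casimir, casimir, h, inv_neg]; ring
    rw [h1, h2] at hfe
    have := mul_left_cancel₀ (normFactor_ne_zero hq hn b')
      (show _ = normFactor hq b' * (casimir hq b' + casimir hq (c.val : ZMod (n ^ 2))) by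
        rw [← hfe]; ring)
    linear_combination -this

variable [CharZero k] (hn : Even n)

theorem diagonal_mem_range {g : QGen} {d : Index n → Coeff k} (h : genMatrix hq g = diagonal d) :
    diagonal d ∈ (rep hq hn).range := ⟨gen n q g, (rep_gen hq hn g).trans h⟩

theorem genMatrix_mem_range (g : QGen) : genMatrix hq g ∈ (rep hq hn).range :=
  ⟨gen n q g, rep_gen hq hn g⟩

theorem diagonal_feCoeff_mem_range : diagonal (feCoeff hq) ∈ (rep hq hn).range := by
  rw [← genMatrix_F_mul_E]
  exact mul_mem (genMatrix_mem_range hq hn _) (genMatrix_mem_range hq hn _)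

/-- The image contains the diagonal matrix units, because the diagonal matrices of `κ`, `κ̂` and `F E`
separate the indices. -/
theorem single_one_mem_range (i : Index n) : single i i 1 ∈ (rep hq hn).range := by
  have := single_mem_of_separates ((rep hq hn).range.comap (diagonalAlgHom k)) i fun j hj => by
    by_contra! hc
    refine hj (index_ext hq hn ?_ ?_ ?_)
    · simpa using hc (fun i => algebraMap k _ (kCoeff hq i))
        (diagonal_mem_range hq hn (g := .K) (weightedPerm_one _)) fun l => algebraMap_mem _ _
    · simpa using hc (fun i => algebraMap k _ (khatCoeff hq i))
        (diagonal_mem_range hq hn (g := .Khat) (weightedPerm_one _)) fun l => algebraMap_mem _ _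
    · exact hc _ (diagonal_feCoeff_mem_range hq hn) fun l => by simp [feCoeff, mem_evenCoeff]
  rw [Subalgebra.mem_comap] at this
  convert this using 1
  ext1 a b
  by_cases hab : a = b
  · subst hab
    by_cases ha : a = i
    · subst ha; simp
    · simp [ha, Ne.symm ha]
  · simp only [single_apply, diagonalAlgHom_apply, diagonal_apply, if_neg hab]
    rw [if_neg]
    rintro ⟨rfl, rfl⟩
    exact hab rfl

/-- The `xy`-component of `F E` never vanishes, so the image contains `xy` times each diagonal matrix
unit. -/
theorem single_even_mem_range (i : Index n) {z : Coeff k} (hz : z ∈ evenCoeff k) :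
    single i i z ∈ (rep hq hn).range := by
  have h1 := single_one_mem_range hq hn i
  have h2 := mul_mem (diagonal_feCoeff_mem_range hq hn) h1
  have h3 := normFactor_ne_zero hq hn i.2
  have : single i i z = (c1 z - cw z * (normFactor hq i.2)⁻¹ * c1 (feCoeff hq i)) • single i i 1 +
      (cw z * (normFactor hq i.2)⁻¹) • (diagonal (feCoeff hq) * single i i 1) := by
    have h4 : diagonal (feCoeff hq) * single i i 1 = single i i (feCoeff hq i) := by
      ext1 a b
      rw [diagonal_mul, single_apply, single_apply]
      split_ifs with h
      · rw [h.1, mul_one]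
      · rw [mul_zero]
    rw [h4, smul_single, smul_single, ← single_add]
    congr 1
    have := mem_evenCoeff.1 hz
    ext <;> simp [feCoeff, this]
    field_simp
  rw [this]
  exact add_mem (Subalgebra.smul_mem _ h1 _) (Subalgebra.smul_mem _ h2 _)

theorem single_eCoeff_mem_range (t : Block n) (b : ZMod (n ^ 2)) :
    single (t, b + 1) (t, b) (eCoeff (t, b)) ∈ (rep hq hn).range := by
  have : single (t, b + 1) (t, b) (eCoeff (t, b)) = genMatrix hq .E * single (t, b) (t, b) 1 := by
    ext1 i j
    rw [mul_apply, Finset.sum_eq_single (t, b)]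
    · simp only [genMatrix, weightedPerm_apply, shift_apply, single_apply, true_and]
      by_cases hi : i = (t, b + 1) <;> by_cases hj : (t, b) = j <;> simp [hi, hj, eq_comm]
    · intro l _ hl
      simp [Ne.symm hl]
    · simp
  rw [this]
  exact mul_mem (genMatrix_mem_range hq hn _) (single_one_mem_range hq hn _)

theorem single_fCoeff_mem_range (t : Block n) (b : ZMod (n ^ 2)) :
    single (t, b) (t, b + 1) (fCoeff hq (t, b)) ∈ (rep hq hn).range := by
  have : single (t, b) (t, b + 1) (fCoeff hq (t, b)) =
      genMatrix hq .F * single (t, b + 1) (t, b + 1) 1 := by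
    ext1 i j
    rw [mul_apply, Finset.sum_eq_single (t, b + 1)]
    · simp only [genMatrix, weightedPerm_apply, shift_inv_apply, single_apply, true_and,
        add_sub_cancel_right]
      by_cases hi : i = (t, b) <;> by_cases hj : (t, b + 1) = j <;> simp [hi, hj, eq_comm]
    · intro l _ hl
      simp [Ne.symm hl]
    · simp
  rw [this]
  exact mul_mem (genMatrix_mem_range hq hn _) (single_one_mem_range hq hn _)

/-- Two indices are linked if the image of the representation contains the two matrix units between
them. -/
def Linked (i j : Index n) : Prop :=
  single i j 1 ∈ (rep hq hn).range ∧ single j i 1 ∈ (rep hq hn).range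

variable {hq hn}

theorem Linked.symm {i j : Index n} (h : Linked hq hn i j) : Linked hq hn j i := ⟨h.2, h.1⟩

theorem Linked.trans {i j l : Index n} (h : Linked hq hn i j) (h' : Linked hq hn j l) :
    Linked hq hn i l := by
  refine ⟨?_, ?_⟩
  · simpa using mul_mem h.1 h'.1
  · simpa using mul_mem h'.2 h.2

theorem Linked.single_mem {i i' j j' : Index n} (hi : Linked hq hn i i') (hj : Linked hq hn j j')
    {z : Coeff k} (hz : single i j z ∈ (rep hq hn).range) :
    single i' j' z ∈ (rep hq hn).range := by
  simpa using mul_mem (mul_mem hi.2 hz) hj.1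

variable (hq hn)

/-- Away from the crossings, `E` acts by `1` and `F` by an invertible coefficient. -/
theorem linked_add_one {t : Block n} {b : ZMod (n ^ 2)} (h : ¬IsCrossing t.1 b) :
    Linked hq hn (t, b + 1) (t, b) := by
  refine ⟨?_, ?_⟩
  · have := single_eCoeff_mem_range hq hn t b
    rwa [eCoeff, if_neg h] at this
  · have h1 := single_fCoeff_mem_range hq hn t b
    rw [fCoeff, if_neg h] at h1
    have h2 : c1 (feCoeff hq (t, b)) ≠ 0 := by
      rw [isCrossing_iff hq] at h
      exact mul_ne_zero (normFactor_ne_zero hq hn b) (sub_ne_zero.2 h)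
    -- The inverse of the even element `r + s xy` is `1 / r - (s / r²) xy`.
    have h3 := single_even_mem_range hq hn (t, b) (z := Coeff.mk (c1 (feCoeff hq (t, b)))⁻¹ 0 0
      (-(cw (feCoeff hq (t, b)) / c1 (feCoeff hq (t, b)) ^ 2))) (by simp [mem_evenCoeff])
    have h4 := mul_mem h3 h1
    rw [single_mul_single_same] at h4
    convert h4 using 2
    have h5 : cx (feCoeff hq (t, b)) = 0 := rfl
    have h6 : cy (feCoeff hq (t, b)) = 0 := rfl
    ext <;> simp [h2, h5, h6]
    field_simp
    ring

theorem linked_true (t : Block n) (m : ℕ) (hm : m ≤ 2 * t.1.val) :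
    Linked hq hn (t, -(t.1.val : ZMod (n ^ 2)) + m) (t, -(t.1.val : ZMod (n ^ 2))) := by
  have hc := four_mul_lt t.1
  induction m with
  | zero =>
    rw [Nat.cast_zero, add_zero]
    exact ⟨single_one_mem_range hq hn _, single_one_mem_range hq hn _⟩
  | succ m ih =>
    refine Linked.trans ?_ (ih (by omega))
    rw [Nat.cast_add, Nat.cast_one, ← add_assoc]
    refine linked_add_one hq hn ?_
    rintro (h | h)
    · have : (m : ZMod (n ^ 2)) = (2 * t.1.val : ℕ) := by
        push_cast
        linear_combination h
      rw [natCast_eq_iff_of_lt (by omega) (by omega)] at this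
      omega
    · have : ((m + 1 : ℕ) : ZMod (n ^ 2)) = (0 : ℕ) := by
        push_cast
        linear_combination h
      rw [natCast_eq_iff_of_lt (by omega) (by omega)] at this
      omega

theorem linked_false (t : Block n) (m : ℕ) (hm : m + (2 * t.1.val + 1) < n ^ 2) :
    Linked hq hn (t, (t.1.val : ZMod (n ^ 2)) + 1 + m) (t, (t.1.val : ZMod (n ^ 2)) + 1) := by
  induction m with
  | zero =>
    rw [Nat.cast_zero, add_zero]
    exact ⟨single_one_mem_range hq hn _, single_one_mem_range hq hn _⟩
  | succ m ih =>
    refine Linked.trans ?_ (ih (by omega))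
    rw [Nat.cast_add m 1, Nat.cast_one, ← add_assoc]
    refine linked_add_one hq hn ?_
    rintro (h | h)
    · have : ((m + 1 : ℕ) : ZMod (n ^ 2)) = (0 : ℕ) := by
        push_cast
        linear_combination h
      rw [natCast_eq_iff_of_lt (by omega) (by omega)] at this
      omega
    · have : ((m + 2 * t.1.val + 2 : ℕ) : ZMod (n ^ 2)) = (0 : ℕ) := by
        push_cast
        linear_combination h
      rw [natCast_eq_iff_of_lt (by omega) (by omega)] at this
      omega

/-- Each weight vector is linked to the lowest weight vector of its simple module, since there is no
crossing between them. -/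
theorem linked_lowest (i : Index n) : Linked hq hn i (lowest (vertex i)) := by
  obtain ⟨t, b⟩ := i
  have hlt := ZMod.val_lt (b + (t.1.val : ZMod (n ^ 2)))
  have hcast : (((b + (t.1.val : ZMod (n ^ 2))).val : ℕ) : ZMod (n ^ 2)) = b + t.1.val :=
    ZMod.natCast_zmod_val _
  by_cases hm : (b + (t.1.val : ZMod (n ^ 2))).val ≤ 2 * t.1.val
  · have := linked_true hq hn t _ hm
    rw [hcast, neg_add_cancel_comm_assoc] at this
    simpa [lowest, vertex, hm] using this
  · have := linked_false hq hn t ((b + (t.1.val : ZMod (n ^ 2))).val - (2 * t.1.val + 1)) (by omega)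
    rw [Nat.cast_sub (by omega), hcast] at this
    have hb : (t.1.val : ZMod (n ^ 2)) + 1 + (b + t.1.val - ((2 * t.1.val + 1 : ℕ) : ZMod (n ^ 2)))
        = b := by
      push_cast; ring
    rw [hb] at this
    simpa [lowest, vertex, hm] using this

theorem linked_of_vertex_eq {i j : Index n} (h : vertex i = vertex j) : Linked hq hn i j := by
  have h1 := linked_lowest hq hn i
  rw [h] at h1
  exact h1.trans (linked_lowest hq hn j).symm

/-- The image of the representation contains all elementary matrices with an arrow as entry. -/
theorem single_mem_range {i j : Index n} {z : Coeff k} (hz : z ∈ arrows k (vertex i) (vertex j)) :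
    single i j z ∈ (rep hq hn).range := by
  obtain ⟨h1, h2, h3⟩ := mem_arrows.1 hz
  by_cases ht : (vertex i).1 = (vertex j).1
  swap
  · rw [h1 ht, single_zero]
    exact zero_mem _
  by_cases hs : (vertex i).2 = (vertex j).2
  · have hl := linked_of_vertex_eq hq hn (Prod.ext ht hs)
    exact Linked.single_mem ⟨single_one_mem_range hq hn i, single_one_mem_range hq hn i⟩ hl
      (single_even_mem_range hq hn i (h2 hs))
  obtain ⟨t, b⟩ := i
  obtain ⟨t', b'⟩ := j
  obtain rfl : t = t' := ht
  have hc := four_mul_lt t.1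
  have v1 : vertex (t, (t.1.val : ZMod (n ^ 2))) = (t, true) := by
    have := vertex_eq_true (t := t) le_rfl
    rwa [Nat.cast_mul, Nat.cast_two, two_mul, neg_add_cancel_left] at this
  have v2 : vertex (t, (t.1.val : ZMod (n ^ 2)) + 1) = (t, false) := vertex_lowest (t, false)
  have v3 : vertex (t, -1 - (t.1.val : ZMod (n ^ 2)) + 1) = (t, true) := by
    have := vertex_lowest (t, true)
    rwa [lowest, if_pos rfl, show -(t.1.val : ZMod (n ^ 2)) = -1 - t.1.val + 1 by ring] at this
  have v4 : vertex (t, -1 - (t.1.val : ZMod (n ^ 2))) = (t, false) := by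
    have := vertex_eq_false (t := t) (m := n ^ 2 - (2 * t.1.val + 2)) (by omega)
    rwa [Nat.cast_sub (by omega), ZMod.natCast_self, show (t.1.val : ZMod (n ^ 2)) + 1 +
      (0 - ((2 * t.1.val + 2 : ℕ) : ZMod (n ^ 2))) = -1 - t.1.val by push_cast; ring] at this
  have hv (b : ZMod (n ^ 2)) : vertex (t, b) = (t, (vertex (t, b)).2) := rfl
  have hXY : single (t, b) (t, b') (X : Coeff k) ∈ (rep hq hn).range ∧
      single (t, b) (t, b') (Y : Coeff k) ∈ (rep hq hn).range := by
    have e1 := single_eCoeff_mem_range hq hn t (t.1.val : ZMod (n ^ 2))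
    have e2 := single_eCoeff_mem_range hq hn t (-1 - (t.1.val : ZMod (n ^ 2)))
    have f1 := single_fCoeff_mem_range hq hn t (t.1.val : ZMod (n ^ 2))
    have f2 := single_fCoeff_mem_range hq hn t (-1 - (t.1.val : ZMod (n ^ 2)))
    rw [eCoeff, if_pos (by exact Or.inl rfl)] at e1
    rw [eCoeff, if_pos (by exact Or.inr rfl)] at e2
    rw [fCoeff, if_pos (by exact Or.inl rfl)] at f1
    rw [fCoeff, if_pos (by exact Or.inr rfl)] at f2
    have hY {i j : Index n} {b : ZMod (n ^ 2)}
        (h : single i j (normFactor hq b • (Y : Coeff k)) ∈ (rep hq hn).range) :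
        single i j (Y : Coeff k) ∈ (rep hq hn).range := by
      have := Subalgebra.smul_mem _ h (normFactor hq b)⁻¹
      rwa [smul_single, smul_smul, inv_mul_cancel₀ (normFactor_ne_zero hq hn b), one_smul] at this
    cases hb : (vertex (t, b)).2
    · have hb' : (vertex (t, b')).2 = true := by
        rw [hb] at hs
        simpa using hs
      have w := hv b
      have w' := hv b'
      rw [hb] at w
      rw [hb'] at w'
      exact ⟨(linked_of_vertex_eq hq hn (v2.trans w.symm)).single_mem
          (linked_of_vertex_eq hq hn (v1.trans w'.symm)) e1,
        (linked_of_vertex_eq hq hn (v4.trans w.symm)).single_mem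
          (linked_of_vertex_eq hq hn (v3.trans w'.symm)) (hY f2)⟩
    · have hb' : (vertex (t, b')).2 = false := by
        rw [hb] at hs
        simpa using hs
      have w := hv b
      have w' := hv b'
      rw [hb] at w
      rw [hb'] at w'
      exact ⟨(linked_of_vertex_eq hq hn (v3.trans w.symm)).single_mem
          (linked_of_vertex_eq hq hn (v4.trans w'.symm)) e2,
        (linked_of_vertex_eq hq hn (v1.trans w.symm)).single_mem
          (linked_of_vertex_eq hq hn (v2.trans w'.symm)) (hY f1)⟩
  have : single (t, b) (t, b') z = cx z • single (t, b) (t, b') (X : Coeff k) +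
      cy z • single (t, b) (t, b') (Y : Coeff k) := by
    rw [smul_single, smul_single, ← single_add]
    congr 1
    ext <;> simp [X, Y, h3 hs]
  rw [this]
  exact add_mem (Subalgebra.smul_mem _ hXY.1 _) (Subalgebra.smul_mem _ hXY.2 _)

/-- The arrow-valued matrices in coordinates. -/
def arrowMatrix : ((Block n × ZMod (n ^ 2) × ZMod (n ^ 2)) × Bool → k) →ₗ[k]
    Matrix (Index n) (Index n) (Coeff k) where
  toFun f := .of fun i j => if i.1 = j.1 then
    (if (vertex i).2 = (vertex j).2
      then Coeff.mk (f ((i.1, i.2, j.2), true)) 0 0 (f ((i.1, i.2, j.2), false))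
      else Coeff.mk 0 (f ((i.1, i.2, j.2), true)) (f ((i.1, i.2, j.2), false)) 0) else 0
  map_add' f g := by
    ext1 i j
    rw [Matrix.add_apply]
    simp only [of_apply]
    split_ifs <;> ext <;> simp
  map_smul' r f := by
    ext1 i j
    rw [RingHom.id_apply, Matrix.smul_apply]
    simp only [of_apply]
    split_ifs <;> ext <;> simp

theorem arrowMatrix_apply (f : (Block n × ZMod (n ^ 2) × ZMod (n ^ 2)) × Bool → k) (i j : Index n) :
    arrowMatrix f i j = if i.1 = j.1 then
    (if (vertex i).2 = (vertex j).2
      then Coeff.mk (f ((i.1, i.2, j.2), true)) 0 0 (f ((i.1, i.2, j.2), false))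
      else Coeff.mk 0 (f ((i.1, i.2, j.2), true)) (f ((i.1, i.2, j.2), false)) 0) else 0 := rfl

theorem arrowMatrix_injective : Function.Injective (arrowMatrix (k := k) (n := n)) := by
  intro f g hfg
  ext ⟨⟨t, a, b⟩, s⟩
  have := congrFun (congrFun hfg (t, a)) (t, b)
  rw [arrowMatrix_apply, arrowMatrix_apply, if_pos rfl, if_pos rfl] at this
  split_ifs at this
  · have h1 := congrArg c1 this
    have h2 := congrArg cw this
    cases s
    · simpa using h2
    · simpa using h1
  · have h1 := congrArg cx this
    have h2 := congrArg cy this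
    cases s
    · simpa using h2
    · simpa using h1

theorem arrowMatrix_mem (f : (Block n × ZMod (n ^ 2) × ZMod (n ^ 2)) × Bool → k) (i j : Index n) :
    arrowMatrix f i j ∈ arrows k (vertex i) (vertex j) := by
  have hv (i : Index n) : (vertex i).1 = i.1 := rfl
  rw [arrowMatrix_apply, mem_arrows, hv, hv]
  split_ifs with h1 h2 <;> simp [*]

theorem mem_range_of_arrows {M : Matrix (Index n) (Index n) (Coeff k)}
    (h : ∀ i j, M i j ∈ arrows k (vertex i) (vertex j)) : M ∈ (rep hq hn).range := by
  rw [matrix_eq_sum_single M]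
  exact sum_mem fun i _ => sum_mem fun j _ => single_mem_range hq hn (h i j)

theorem finrank_arrowMatrix :
    Module.finrank k (LinearMap.range (arrowMatrix (k := k) (n := n))) =
      (n ^ 2 / 4 * 4) * n ^ 2 * n ^ 2 := by
  rw [LinearMap.finrank_range_of_inj arrowMatrix_injective, Module.finrank_fintype_fun_eq_card]
  simp only [Fintype.card_prod, Fintype.card_fin, Fintype.card_units_int, ZMod.card,
    Fintype.card_bool]
  ring

/-- The representation is faithful with image the algebra of arrow-valued matrices. By the lower
bound on the image and the upper bound on the algebra, all dimensions are `n⁶`. -/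
theorem isArrowMatrixAlgebra_rep : IsArrowMatrixAlgebra vertex (rep hq hn) := by
  have h4 : n ^ 2 / 4 * 4 = n ^ 2 := by
    refine Nat.div_mul_cancel ?_
    obtain ⟨m, rfl⟩ := hn.two_dvd
    exact ⟨m ^ 2, by ring⟩
  have hle : LinearMap.range (arrowMatrix (k := k) (n := n)) ≤
      LinearMap.range (rep hq hn).toLinearMap := by
    rintro _ ⟨f, rfl⟩
    exact mem_range_of_arrows hq hn (arrowMatrix_mem f)
  have h1 := Submodule.finrank_mono hle
  rw [finrank_arrowMatrix, h4] at h1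
  have h2 := finrank_le n q
  have h3 := (rep hq hn).toLinearMap.finrank_range_add_finrank_ker
  have hker : LinearMap.ker (rep hq hn).toLinearMap = ⊥ := by
    rw [← Submodule.finrank_eq_zero (R := k)]
    omega
  have heq := Submodule.eq_of_le_of_finrank_le hle (by rw [finrank_arrowMatrix, h4]; omega)
  refine ⟨LinearMap.ker_eq_bot.1 hker, fun M => ⟨fun hM => ?_, mem_range_of_arrows hq hn⟩⟩
  have : M ∈ LinearMap.range (rep hq hn).toLinearMap := hM
  rw [← heq] at this
  obtain ⟨f, rfl⟩ := this
  exact arrowMatrix_mem f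

end Image

end Qusl2

/-! ### Group algebras of finite cyclic groups -/

section Fourier

variable {k : Type u} [Field k]

/-- The discrete Fourier transform: in the presence of a primitive `m`-th root of unity, the group
algebra of the cyclic group of order `m` is a power of the ground field. -/
theorem nonempty_monoidAlgebra_algEquiv {m : ℕ} [NeZero m] {ζ : k} (hζ : IsPrimitiveRoot ζ m)
    {T : Type*} [Fintype T] (hT : Fintype.card T = m) :
    Nonempty (MonoidAlgebra k (Multiplicative (ZMod m)) ≃ₐ[k] (T → k)) := by
  let e : AddChar (ZMod m) k := AddChar.zmodChar m hζ.pow_eq_one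
  have he : e.IsPrimitive := AddChar.zmodChar_primitive_of_primitive_root m hζ
  let v : ZMod m → ZMod m → k := fun a j => e (a * j)
  let F : Multiplicative (ZMod m) →* (ZMod m → k) :=
    { toFun := fun a => v a.toAdd
      map_one' := by ext j; simp [v]
      map_mul' := fun a b => by ext j; simp [v, add_mul, AddChar.map_add_eq_mul] }
  have hv : LinearIndependent k v := by
    have hinj : Function.Injective fun a : ZMod m => (e.mulShift a).toMonoidHom := by
      intro a b hab
      refine AddChar.to_mulShift_inj_of_isPrimitive he ?_
      ext j
      exact DFunLike.congr_fun hab (Multiplicative.ofAdd j)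
    exact (linearIndependent_monoidHom (Multiplicative (ZMod m)) k).comp _ hinj
  have hspan : Submodule.span k (Set.range v) = ⊤ :=
    hv.span_eq_top_of_card_eq_finrank' (by simp)
  let φ := MonoidAlgebra.lift k (ZMod m → k) (Multiplicative (ZMod m)) F
  have hsurj : Function.Surjective φ := by
    rw [← AlgHom.coe_toLinearMap, ← LinearMap.range_eq_top, eq_top_iff, ← hspan,
      Submodule.span_le]
    rintro _ ⟨a, rfl⟩
    exact ⟨MonoidAlgebra.of k _ (Multiplicative.ofAdd a), MonoidAlgebra.lift_of _ _⟩
  have hfin : Module.Finite k (MonoidAlgebra k (Multiplicative (ZMod m))) :=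
    Module.Finite.equiv (MonoidAlgebra.coeffLinearEquiv k).symm
  have hrank : Module.finrank k (MonoidAlgebra k (Multiplicative (ZMod m))) =
      Module.finrank k (ZMod m → k) := by
    rw [(MonoidAlgebra.coeffLinearEquiv k).finrank_eq, Module.finrank_finsupp_self,
      Module.finrank_fintype_fun_eq_card, Fintype.card_multiplicative]
  have hbij : Function.Bijective φ :=
    ⟨(LinearMap.injective_iff_surjective_of_finrank_eq_finrank (f := φ.toLinearMap) hrank).2 hsurj,
      hsurj⟩
  let σ : ZMod m ≃ T := Fintype.equivOfCardEq (by rw [hT, ZMod.card])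
  exact ⟨(AlgEquiv.ofBijective φ hbij).trans (AlgEquiv.piCongrLeft k (fun _ => k) σ)⟩

end Fourier

/-! ### Transport of Hopf algebra structures -/

section Transport

open Coalgebra

variable {k A H : Type*} [Field k] [Semiring A] [instA : Algebra k A] [Semiring H] [HopfAlgebra k H]

/-- A Hopf algebra structure can be transported along an isomorphism of algebras. -/
theorem exists_hopfAlgebra_of_algEquiv (φ : A ≃ₐ[k] H) :
    ∃ S : HopfAlgebra k A, S.toAlgebra = instA ∧
      Nonempty (@BialgEquiv k _ A H _ _ S.toAlgebra _ S.toCoalgebra.toCoalgebraStruct _) := by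
  let ψ : H →ₐ[k] A := φ.symm
  let ψψ : H ⊗[k] H →ₐ[k] A ⊗[k] A := Algebra.TensorProduct.map ψ ψ
  let Δ : A →ₐ[k] A ⊗[k] A := ψψ.comp ((Bialgebra.comulAlgHom k H).comp (φ : A →ₐ[k] H))
  let ε : A →ₐ[k] k := (Bialgebra.counitAlgHom k H).comp (φ : A →ₐ[k] H)
  have hΔ (a : A) : Δ a = ψψ (comul (R := k) (φ a)) := rfl
  have hε (a : A) : ε a = counit (R := k) (φ a) := rfl
  have hψφ (a : A) : ψ (φ a) = a := φ.symm_apply_apply a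
  have hφψ (x : H) : φ (ψ x) = x := φ.apply_symm_apply x
  have hψψ (x y : H) : ψψ (x ⊗ₜ y) = ψ x ⊗ₜ ψ y := rfl
  have assoc1 (t : H ⊗[k] H) : Algebra.TensorProduct.assoc k k k A A A
      (Algebra.TensorProduct.map Δ (.id k A) (ψψ t)) = Algebra.TensorProduct.map ψ ψψ
        (TensorProduct.assoc k H H H ((comul (R := k) (A := H)).rTensor H t)) := by
    induction t using TensorProduct.induction_on with
    | zero => simp
    | add t t' h h' => simp only [map_add, h, h']
    | tmul x y =>
      rw [hψψ, Algebra.TensorProduct.map_tmul, hΔ, hφψ, LinearMap.rTensor_tmul]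
      induction comul (R := k) x using TensorProduct.induction_on with
      | zero => simp
      | add t t' h h' => simp only [map_add, TensorProduct.add_tmul, h, h']
      | tmul u v => simp [hψψ]
  have assoc2 (t : H ⊗[k] H) : Algebra.TensorProduct.map (.id k A) Δ (ψψ t) =
      Algebra.TensorProduct.map ψ ψψ ((comul (R := k) (A := H)).lTensor H t) := by
    induction t using TensorProduct.induction_on with
    | zero => simp
    | add t t' h h' => simp only [map_add, h, h']
    | tmul x y =>
      rw [hψψ, Algebra.TensorProduct.map_tmul, hΔ, hφψ, LinearMap.lTensor_tmul,
        Algebra.TensorProduct.map_tmul]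
      rfl
  have unit1 (t : H ⊗[k] H) : Algebra.TensorProduct.map ε (.id k A) (ψψ t) =
      Algebra.TensorProduct.map (.id k k) ψ ((counit (R := k) (A := H)).rTensor H t) := by
    induction t using TensorProduct.induction_on with
    | zero => simp
    | add t t' h h' => simp only [map_add, h, h']
    | tmul x y => simp [hψψ, hε, hφψ]
  have unit2 (t : H ⊗[k] H) : Algebra.TensorProduct.map (.id k A) ε (ψψ t) =
      Algebra.TensorProduct.map ψ (.id k k) ((counit (R := k) (A := H)).lTensor H t) := by
    induction t using TensorProduct.induction_on with
    | zero => simp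
    | add t t' h h' => simp only [map_add, h, h']
    | tmul x y => simp [hψψ, hε, hφψ]
  let B : Bialgebra k A := Bialgebra.ofAlgHom Δ ε
    (AlgHom.ext fun a => by
      change Algebra.TensorProduct.assoc k k k A A A
        (Algebra.TensorProduct.map Δ (.id k A) (ψψ (comul (R := k) (φ a)))) =
        Algebra.TensorProduct.map (.id k A) Δ (ψψ (comul (R := k) (φ a)))
      rw [assoc1, assoc2, coassoc_apply])
    (AlgHom.ext fun a => by
      change Algebra.TensorProduct.map ε (.id k A) (ψψ (comul (R := k) (φ a))) = _
      rw [unit1, rTensor_counit_comul]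
      simp [hψφ])
    (AlgHom.ext fun a => by
      change Algebra.TensorProduct.map (.id k A) ε (ψψ (comul (R := k) (φ a))) = _
      rw [unit2, lTensor_counit_comul]
      simp [hψφ])
  let S : A →ₗ[k] A := ψ.toLinearMap ∘ₗ HopfAlgebra.antipode k ∘ₗ φ.toLinearMap
  have hS (x : H) : S (ψ x) = ψ (HopfAlgebra.antipode k x) :=
    congrArg (fun y => ψ (HopfAlgebra.antipode k y)) (hφψ x)
  have anti1 (t : H ⊗[k] H) : LinearMap.mul' k A (S.rTensor A (ψψ t)) =
      ψ (LinearMap.mul' k H ((HopfAlgebra.antipode k).rTensor H t)) := by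
    induction t using TensorProduct.induction_on with
    | zero => simp
    | add t t' h h' => simp only [map_add, h, h']
    | tmul x y => simp [hψψ, hS]
  have anti2 (t : H ⊗[k] H) : LinearMap.mul' k A (S.lTensor A (ψψ t)) =
      ψ (LinearMap.mul' k H ((HopfAlgebra.antipode k).lTensor H t)) := by
    induction t using TensorProduct.induction_on with
    | zero => simp
    | add t t' h h' => simp only [map_add, h, h']
    | tmul x y => simp [hψψ, hS]
  let K : HopfAlgebra k A :=
    { B with
      antipode := S
      mul_antipode_rTensor_comul := LinearMap.ext fun a => by
        change LinearMap.mul' k A (S.rTensor A (ψψ (comul (R := k) (φ a)))) =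
          algebraMap k A (counit (R := k) (φ a))
        rw [anti1, HopfAlgebra.mul_antipode_rTensor_comul_apply, AlgHom.commutes]
      mul_antipode_lTensor_comul := LinearMap.ext fun a => by
        change LinearMap.mul' k A (S.lTensor A (ψψ (comul (R := k) (φ a)))) =
          algebraMap k A (counit (R := k) (φ a))
        rw [anti2, HopfAlgebra.mul_antipode_lTensor_comul_apply, AlgHom.commutes] }
  have map1 (t : H ⊗[k] H) :
      Algebra.TensorProduct.map (φ : A →ₐ[k] H) (φ : A →ₐ[k] H) (ψψ t) = t := by
    induction t using TensorProduct.induction_on with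
    | zero => simp
    | add t t' h h' => simp only [map_add, h, h']
    | tmul x y => simp [hψψ, hφψ]
  exact ⟨K, rfl, ⟨BialgEquiv.ofAlgEquiv φ rfl (AlgHom.ext fun a => map1 _)⟩⟩

end Transport

end QuasiFL

end

theorem proposition2p15 (k : Type*) [Field k] [IsAlgClosed k] [CharZero k]
    (n : ℕ) (hn : 0 < n) (h4 : 4 ∣ n) (q : k) (hq : IsPrimitiveRoot q (n ^ 2)) :
    (∃ e : QuasiFL.Qusl2 k n q, QuasiFL.IsBasicIdempotent e) ∧
    ∀ (e : QuasiFL.Qusl2 k n q) (he : QuasiFL.IsBasicIdempotent e),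
      ∃ H : HopfAlgebra k he.idem.Corner,
        H.toAlgebra = QuasiFL.cornerAlgebra he.idem ∧
        Nonempty (@BialgEquiv k _ he.idem.Corner
          (QuasiFL.Book k ⊗[k] MonoidAlgebra k (Multiplicative (ZMod (n ^ 2 / 2)))) _ _
          H.toAlgebra _ H.toCoalgebra.toCoalgebraStruct _) := by
  have : NeZero n := ⟨hn.ne'⟩
  have heven : Even n := even_iff_two_dvd.2 (dvd_trans (by norm_num) h4)
  have h4n : 4 ∣ n ^ 2 := h4.trans (dvd_pow_self n two_ne_zero)
  have hpos : 0 < n ^ 2 := pow_pos hn 2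
  have : NeZero (n ^ 2 / 2) := ⟨by omega⟩
  have hrep := QuasiFL.Qusl2.isArrowMatrixAlgebra_rep hq heven
  have hbasic := hrep.isBasicIdempotent (o := QuasiFL.Qusl2.lowest) QuasiFL.Qusl2.vertex_lowest
  refine ⟨⟨_, hbasic⟩, fun e he => ?_⟩
  obtain ⟨φ₁⟩ := (he.idemEquiv hbasic).nonempty_corner_algEquiv (k := k) he.idem hbasic.idem
  obtain ⟨φ₂⟩ := hrep.nonempty_corner_algEquiv QuasiFL.Qusl2.vertex_lowest hbasic.idem
  have hζ : IsPrimitiveRoot (q ^ 2) (n ^ 2 / 2) := hq.pow hpos (by omega)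
  obtain ⟨φ₃⟩ := QuasiFL.nonempty_monoidAlgebra_algEquiv (T := QuasiFL.Qusl2.Block n) hζ (by
    rw [Fintype.card_prod, Fintype.card_fin, Fintype.card_units_int]
    omega)
  let φ₄ : he.idem.Corner ≃ₐ[k]
      QuasiFL.Book k ⊗[k] MonoidAlgebra k (Multiplicative (ZMod (n ^ 2 / 2))) :=
    φ₁.trans (φ₂.trans
      ((Algebra.TensorProduct.piScalarRight k k (QuasiFL.Book k) (QuasiFL.Qusl2.Block n)).symm.trans
        (Algebra.TensorProduct.congr AlgEquiv.refl φ₃.symm)))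
  exact QuasiFL.exists_hopfAlgebra_of_algEquiv (k := k) (A := he.idem.Corner)
    (H := QuasiFL.Book k ⊗[k] MonoidAlgebra k (Multiplicative (ZMod (n ^ 2 / 2)))) φ₄
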